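/- Consider the asynchronous crash-prone $\mathsf{LOCAL}$ model ($\mathsf{ASYNC\ LOCAL}$) on a finite simple connected graph $G=(V,E)$. The nodes carry pairwise distinct identifiers $\mathrm{id}(v)\in\{1,\dots,N\}$, and possibly an input $\mathrm{inp}(v)$. A (deterministic) algorithm consists of two functions $\mathrm{init}$ and $\mathrm{next}$, together with special states $\mathrm{term}(x)$ that mean "terminated with output $x$". A scheduling is a sequence $S_1,S_2,\dots$ of subsets of $V$. Put $\mathrm{old}_{v,1}=\bot$ and $\mathrm{new}_{v,1}=\mathrm{init}(\mathrm{id}(v),\mathrm{inp}(v))$. At step $i\ge 1$, a node $v\notin S_i$ keeps its values $\mathrm{old}_{v,i+1}=\mathrm{old}_{v,i}$ and $\mathrm{new}_{v,i+1}=\mathrm{new}_{v,i}$. The nodes $v\in S_i$ concurrently write, $\mathrm{old}_{v,i+1}=\mathrm{new}_{v,i}$, then read the registers of their neighbors and update their states: $\mathrm{new}_{v,i+1}=\mathrm{next}\big(\mathrm{old}_{v,i+1},\{\mathrm{old}_{u,i+1}: u\in N_G(v)\}\big)$ (the read values forming a multiset), except that the state of a terminated node never changes. An algorithm solves $k$-coloring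 of $G$ with identifiers in $\{1,\dots,N\}$ if, for every assignment of pairwise distinct identifiers in $\{1,\dots,N\}$ and every scheduling, every node that is scheduled infinitely often eventually terminates with an output in a fixed set of $k$ colors, and any two adjacent nodes that terminate output different colors. No bound on the number of steps is required. Theorem. Let $n\ge 3$ be a prime number and let $N\ge 2n-1$. Then no deterministic $\mathsf{ASYNC\ LOCAL}$ algorithm solves $4$-coloring of the $n$-node cycle with identifiers in $\{1,\dots,N\}$, whatever its number of rounds, and even if all nodes receive a common input (for instance $n$ and $N$). -/

import Mathlib

namespace AsyncLocal

/-- The state of a node: either still computing, with local memory `q : Q`, or the special state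
`term x`, meaning that the node has terminated with output `x`. -/
inductive NodeState (Q C : Type*) where
  | run (q : Q) : NodeState Q C
  | term (x : C) : NodeState Q C

/-- A deterministic algorithm: `init` computes the initial state of a node from its identifier and
its input; `next` computes the new state of a (non-terminated) node from the state that it has just
written in its register and from the contents of the registers of its neighbors, where `none` is
the content `⊥` of a register that has never been written. The functions are arbitrary and states
have unbounded size. -/
structure Algorithm (I Q C : Type*) where
  init : ℕ → I → NodeState Q C
  next : Q → Multiset (Option (NodeState Q C)) → NodeState Q C

/-- A global configuration: `old v` is the content of the register of `v`, i.e. what the neighbors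
of `v` read, and `new v` is the current state of `v`, which becomes visible to the neighbors of `v`
the next time that `v` is scheduled. -/
structure Config (V Q C : Type*) where
  old : V → Option (NodeState Q C)
  new : V → NodeState Q C

namespace Algorithm

/-- The initial configuration, for identifiers `ident` and inputs `inp`. -/
def start {V I Q C : Type*} (A : Algorithm I Q C) (ident : V → ℕ) (inp : V → I) :
    Config V Q C where
  old _ := none
  new v := A.init (ident v) (inp v)

/-- The registers after the nodes in `T` have concurrently written their states. -/
def write {V Q C : Type*} [DecidableEq V] (c : Config V Q C) (T : Finset V) :
    V → Option (NodeState Q C) :=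
  fun v => if v ∈ T then some (c.new v) else c.old v

/-- One step, in which exactly the nodes in `T` are activated: they all write their states, then
they all read the registers of their neighbors in `G` and update their states. The state of a
terminated node never changes. -/
def step {V I Q C : Type*} [Fintype V] [DecidableEq V] (A : Algorithm I Q C)
    (G : SimpleGraph V) [DecidableRel G.Adj] (c : Config V Q C) (T : Finset V) :
    Config V Q C where
  old := write c T
  new v :=
    if v ∈ T then
      match c.new v with
      | .run q => A.next q ((G.neighborFinset v).val.map (write c T))
      | .term x => .term x
    else c.new v

/-- The execution of `A` under the scheduling `S`; the nodes in `S t` are activated between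
the configurations `t` and `t + 1`. -/
def exec {V I Q C : Type*} [Fintype V] [DecidableEq V] (A : Algorithm I Q C)
    (G : SimpleGraph V) [DecidableRel G.Adj] (ident : V → ℕ) (inp : V → I)
    (S : ℕ → Finset V) : ℕ → Config V Q C
  | 0 => A.start ident inp
  | t + 1 => A.step G (exec A G ident inp S t) (S t)

/-- In the execution under the scheduling `S`, node `v` terminates with output `x`. -/
def Decides {V I Q C : Type*} [Fintype V] [DecidableEq V] (A : Algorithm I Q C)
    (G : SimpleGraph V) [DecidableRel G.Adj] (ident : V → ℕ) (inp : V → I)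
    (S : ℕ → Finset V) (v : V) (x : C) : Prop :=
  ∃ t, (A.exec G ident inp S t).new v = .term x

/-- `A` solves proper coloring of `G`, with set of colors `C` and inputs `inp`, for identifiers in
`{1, …, N}`: for all pairwise distinct identifiers in this range and all schedulings, every node
that does not crash (i.e., that is scheduled infinitely often) terminates, and any two adjacent
nodes that terminate output distinct colors. -/
def SolvesColoring {V I Q C : Type*} [Fintype V] [DecidableEq V] (A : Algorithm I Q C)
    (G : SimpleGraph V) [DecidableRel G.Adj] (N : ℕ) (inp : V → I) : Prop :=
  ∀ ident : V → ℕ, Function.Injective ident → (∀ v, 1 ≤ ident v ∧ ident v ≤ N) →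
    ∀ S : ℕ → Finset V,
      (∀ v, (∀ t, ∃ t', t ≤ t' ∧ v ∈ S t') → ∃ x, A.Decides G ident inp S v x) ∧
      (∀ u v, G.Adj u v → ∀ a b, A.Decides G ident inp S u a → A.Decides G ident inp S v b → a ≠ b)

end Algorithm

end AsyncLocal

/-! Giving identifier `j` to node `i` is a square of an `n × N` chessboard, so partial assignments
of distinct identifiers are the simplices of the chessboard complex. A coloring algorithm would
induce a linear map `outMap` from its chains to the chains on the vertex set `Fin n`: a simplex goes
to the signed sum of the outcomes of all executions in which exactly its nodes take part, an output
color being read as a node through `moveNode`.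

This map commutes with boundaries (`bd_outMap`): once a node `v` is ignored, the executions in which
`v` steps alone just before a block `B` cancel those in which it joins `B`, and the executions
without `v` remain (`execSum_erase`). It commutes with rotations (`outMap_chmap`), as the nodes
differ only in their identifiers. In top degree it vanishes (`outMap_eq_zero`): if `moveNode` were
injective on a proper coloring, either all nodes would move or all would stay, and two colors would
suffice for an odd cycle.

Topology forbids such a map. With at least `2 * n - 1` columns, the chessboard complex has no
reduced homology below the top degree (`exists_bd_eq_of_mem_rook`). Starting from a vertex, one can
therefore alternately fill the difference of a chain and its rotation, and the sum of all rotations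
of that filling, up to top degree. Modulo `n = 2 * m + 1`, every equivariant chain map sends the
final chain to the same value `cyc ^ m * vert 0` (`eq_cyc_mul_of_bd`,
`exists_mem_rook_map_eq_cyc_pow_mul`). Up to sign this is `m!` times a generator of the top degree,
which is nonzero because `n` is prime (`cyc_pow_mul_vert_ne_zero`). -/

set_option linter.unusedSectionVars false

open Finset

/-! ### Simplicial chains as an exterior algebra -/

/-- The algebra of (augmented, oriented) simplicial chains on a set `X` of vertices. -/
abbrev Chain (R X : Type*) [CommRing R] := ExteriorAlgebra R (X →₀ R)

namespace Chain

variable {R X Y : Type*} [CommRing R]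

/-- The chain of a single vertex. -/
noncomputable def vert (R : Type*) [CommRing R] {X : Type*} (x : X) : Chain R X :=
  ExteriorAlgebra.ι R (Finsupp.single x 1)

/-- The oriented simplex with a given ordered list of vertices. -/
noncomputable def mono (R : Type*) [CommRing R] {X : Type*} (L : List X) : Chain R X :=
  (L.map (vert R)).prod

/-- The (augmented) boundary operator. -/
noncomputable def bd : Chain R X →ₗ[R] Chain R X :=
  CliffordAlgebra.contractLeft (Finsupp.linearCombination R (fun _ => (1 : R)))

/-- The contraction with a vertex. -/
noncomputable def del (x : X) : Chain R X →ₗ[R] Chain R X :=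
  CliffordAlgebra.contractLeft (Finsupp.lapply x)

/-- The map of chains induced by a map of vertices. -/
noncomputable def chmap (R : Type*) [CommRing R] {X Y : Type*} (f : X → Y) :
    Chain R X →ₐ[R] Chain R Y :=
  ExteriorAlgebra.map (Finsupp.lmapDomain R R f)

@[simp] theorem vert_mul_self (x : X) : vert R x * vert R x = 0 :=
  ExteriorAlgebra.ι_sq_zero _

theorem vert_mul_vert (x y : X) : vert R x * vert R y = -(vert R y * vert R x) :=
  eq_neg_of_add_eq_zero_left (ExteriorAlgebra.ι_add_mul_swap _ _)

theorem vert_mul_vert_mul (x y : X) (a : Chain R X) :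
    vert R x * (vert R y * a) = -(vert R y * (vert R x * a)) := by
  rw [← mul_assoc, vert_mul_vert, neg_mul, mul_assoc]

@[simp] theorem vert_mul_self_mul (x : X) (a : Chain R X) : vert R x * (vert R x * a) = 0 := by
  rw [← mul_assoc, vert_mul_self, zero_mul]

@[simp] theorem mono_nil : mono R ([] : List X) = 1 := rfl

@[simp] theorem mono_cons (x : X) (L : List X) : mono R (x :: L) = vert R x * mono R L := by
  simp [mono]

theorem vert_mul_mono_of_mem {x : X} {L : List X} (h : x ∈ L) : vert R x * mono R L = 0 := by
  induction L with
  | nil => simp at h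
  | cons y L ih =>
    rw [mono_cons]
    rcases List.mem_cons.1 h with rfl | h
    · simp
    · rw [vert_mul_vert_mul, ih h, mul_zero, neg_zero]

theorem mono_eq_zero_of_not_nodup {L : List X} (h : ¬ L.Nodup) : mono R L = 0 := by
  induction L with
  | nil => simp at h
  | cons y L ih =>
    rw [mono_cons]
    by_cases hy : y ∈ L
    · exact vert_mul_mono_of_mem hy
    · rw [ih (fun hL => h (List.nodup_cons.2 ⟨hy, hL⟩)), mul_zero]

@[simp] theorem bd_one : bd (1 : Chain R X) = 0 := CliffordAlgebra.contractLeft_one _ _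

@[simp] theorem bd_bd (a : Chain R X) : bd (bd a) = 0 :=
  CliffordAlgebra.contractLeft_contractLeft _ _

theorem bd_ι_mul (m : X →₀ R) (a : Chain R X) :
    bd (ExteriorAlgebra.ι R m * a) =
      Finsupp.linearCombination R (fun _ => (1 : R)) m • a - ExteriorAlgebra.ι R m * bd a :=
  CliffordAlgebra.contractLeft_ι_mul _ _ _

/-- The cone formula: multiplication by a vertex is a contracting homotopy for the augmented
boundary. -/
theorem bd_vert_mul (x : X) (a : Chain R X) : bd (vert R x * a) = a - vert R x * bd a := by
  simp [vert, bd_ι_mul]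

@[simp] theorem bd_vert (x : X) : bd (vert R x) = 1 := by
  simpa using bd_vert_mul (R := R) x 1

theorem bd_vert_mul_vert_mul (x y : X) (a : Chain R X) :
    bd (vert R x * vert R y * a) = (vert R y - vert R x) * a + vert R x * vert R y * bd a := by
  rw [mul_assoc, bd_vert_mul, bd_vert_mul]
  noncomm_ring

@[simp] theorem del_one (x : X) : del x (1 : Chain R X) = 0 := CliffordAlgebra.contractLeft_one _ _

/-- Contractions anticommute. Consequently the link of a vertex in a cycle is again a cycle. -/
theorem del_bd (x : X) (a : Chain R X) : del x (bd a) = - bd (del x a) :=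
  CliffordAlgebra.contractLeft_comm _ _ _

theorem del_vert_mul_self (x : X) (a : Chain R X) :
    del x (vert R x * a) = a - vert R x * del x a := by
  refine (CliffordAlgebra.contractLeft_ι_mul _ _ _).trans ?_
  simp [vert, del, ExteriorAlgebra.ι]

theorem del_vert_mul_of_ne {x y : X} (h : x ≠ y) (a : Chain R X) :
    del x (vert R y * a) = - (vert R y * del x a) := by
  refine (CliffordAlgebra.contractLeft_ι_mul _ _ _).trans ?_
  simp [vert, del, ExteriorAlgebra.ι, Finsupp.single_eq_of_ne h]

theorem del_mono_of_notMem {x : X} {L : List X} (h : x ∉ L) : del x (mono R L) = 0 := by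
  induction L with
  | nil => simp
  | cons y L ih =>
    rw [List.mem_cons, not_or] at h
    rw [mono_cons, del_vert_mul_of_ne h.1, ih h.2, mul_zero, neg_zero]

/-- Together with `del_mono_of_notMem`, this makes `vert x * del x ·` the projection onto the
simplices that contain `x`. -/
theorem vert_mul_del_mono_of_mem {x : X} {L : List X} (h : x ∈ L) :
    vert R x * del x (mono R L) = mono R L := by
  induction L with
  | nil => simp at h
  | cons y L ih =>
    rw [mono_cons]
    by_cases hx : x = y
    · subst hx
      rw [del_vert_mul_self, mul_sub, vert_mul_self_mul, sub_zero]
    · rw [del_vert_mul_of_ne hx, mul_neg, vert_mul_vert_mul, neg_neg,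
        ih ((List.mem_cons.1 h).resolve_left hx)]

@[simp] theorem chmap_vert (f : X → Y) (x : X) : chmap R f (vert R x) = vert R (f x) := by
  simp [chmap, vert]

@[simp] theorem chmap_mono (f : X → Y) (L : List X) :
    chmap R f (mono R L) = mono R (L.map f) := by
  induction L with
  | nil => simp
  | cons y L ih => simp [ih]

/-- The boundary is contraction with the sum of coefficients, and a map of vertices preserves that
sum. -/
theorem bd_chmap (f : X → Y) (a : Chain R X) : bd (chmap R f a) = chmap R f (bd a) := by
  induction a using CliffordAlgebra.left_induction with
  | algebraMap r =>
    change bd (chmap R f (algebraMap R _ r)) = chmap R f (bd (algebraMap R _ r))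
    rw [AlgHom.commutes, Algebra.algebraMap_eq_smul_one, Algebra.algebraMap_eq_smul_one]
    simp
  | add x y hx hy => simp only [map_add, hx, hy]
  | ι_mul x m hx =>
    change bd (chmap R f (ExteriorAlgebra.ι R m * x)) = chmap R f (bd (ExteriorAlgebra.ι R m * x))
    have e : chmap R f (ExteriorAlgebra.ι R m) = ExteriorAlgebra.ι R (Finsupp.mapDomain f m) := by
      simp [chmap]
    rw [map_mul, e, bd_ι_mul, bd_ι_mul, map_sub, map_mul, map_smul, e, hx]
    congr 2
    simp [Finsupp.linearCombination_mapDomain, Function.comp_def]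

/-- The boundary of a simplex is a combination of its faces. -/
theorem bd_mono_mem (L : List X) :
    bd (mono R L) ∈ Submodule.span R (mono R '' {L' | L'.Sublist L ∧ L'.length + 1 = L.length}) := by
  induction L with
  | nil => simp
  | cons x L ih =>
    rw [mono_cons, bd_vert_mul]
    refine Submodule.sub_mem _ (Submodule.subset_span ⟨L, ⟨List.sublist_cons_self _ _, rfl⟩, rfl⟩) ?_
    refine Submodule.span_induction (p := fun a _ => vert R x * a ∈ _) ?_ ?_ ?_ ?_ ih
    · rintro _ ⟨L', ⟨h, h'⟩, rfl⟩
      exact Submodule.subset_span ⟨x :: L', ⟨h.cons_cons x, by simp [h']⟩, by simp⟩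
    · simp
    · intro a b _ _ ha hb
      rw [mul_add]
      exact add_mem ha hb
    · intro c a _ ha
      rw [mul_smul_comm]
      exact Submodule.smul_mem _ _ ha

theorem del_mono_mem (x : X) {L : List X} (hL : L.Nodup) :
    del x (mono R L) ∈ Submodule.span R
      (mono R '' {L' | L'.Sublist L ∧ L'.length + 1 = L.length ∧ x ∈ L ∧ x ∉ L'}) := by
  induction L with
  | nil => simp
  | cons y L ih =>
    rw [List.nodup_cons] at hL
    rw [mono_cons]
    by_cases hx : x = y
    · subst hx
      rw [del_vert_mul_self, del_mono_of_notMem hL.1, mul_zero, sub_zero]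
      exact Submodule.subset_span
        ⟨L, ⟨List.sublist_cons_self _ _, rfl, List.mem_cons_self, hL.1⟩, rfl⟩
    · rw [del_vert_mul_of_ne hx]
      refine neg_mem ?_
      refine Submodule.span_induction (p := fun a _ => vert R y * a ∈ _) ?_ ?_ ?_ ?_ (ih hL.2)
      · rintro _ ⟨L', ⟨h, h', h1, h2⟩, rfl⟩
        exact Submodule.subset_span
          ⟨y :: L', ⟨h.cons_cons y, by simp [h'], by simp [h1], by simp [hx, h2]⟩, by simp⟩
      · simp
      · intro a b _ _ ha hb
        rw [mul_add]
        exact add_mem ha hb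
      · intro c a _ ha
        rw [mul_smul_comm]
        exact Submodule.smul_mem _ _ ha

end Chain

/-! ### Chessboard complexes and their acyclicity -/

namespace Chain

variable {R : Type*} [CommRing R] {V J : Type*}

/-- A list of `d` squares of a chessboard, in rows `A` and columns `K`, no two of which lie in
the same row or column. -/
structure IsRookList (A : Finset V) (K : Finset J) (d : ℕ) (L : List (V × J)) : Prop where
  length_eq : L.length = d
  row_nodup : (L.map Prod.fst).Nodup
  row_mem : ∀ x ∈ L, x.1 ∈ A
  col_nodup : (L.map Prod.snd).Nodup
  col_mem : ∀ x ∈ L, x.2 ∈ K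

/-- Chains spanned by the simplices with `d` vertices of the chessboard complex with rows `A` and
columns `K`. -/
noncomputable def rook (R : Type*) [CommRing R] (A : Finset V) (K : Finset J) (d : ℕ) :
    Submodule R (Chain R (V × J)) :=
  Submodule.span R (mono R '' {L | IsRookList A K d L})

theorem IsRookList.nodup {A : Finset V} {K : Finset J} {d : ℕ} {L : List (V × J)}
    (h : IsRookList A K d L) : L.Nodup := h.row_nodup.of_map _

theorem IsRookList.sublist {A : Finset V} {K : Finset J} {d : ℕ} {L L' : List (V × J)}
    (h : IsRookList A K d L) (hL : L'.Sublist L) : IsRookList A K L'.length L' where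
  length_eq := rfl
  row_nodup := h.row_nodup.sublist (hL.map _)
  row_mem x hx := h.row_mem x (hL.subset hx)
  col_nodup := h.col_nodup.sublist (hL.map _)
  col_mem x hx := h.col_mem x (hL.subset hx)

theorem mono_mem_rook {A : Finset V} {K : Finset J} {d : ℕ} {L : List (V × J)}
    (h : IsRookList A K d L) : mono R L ∈ rook R A K d :=
  Submodule.subset_span ⟨L, h, rfl⟩

theorem rook_induction {A : Finset V} {K : Finset J} {d : ℕ} {S : Submodule R (Chain R (V × J))}
    (h : ∀ L, IsRookList A K d L → mono R L ∈ S) : rook R A K d ≤ S := by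
  refine Submodule.span_le.2 ?_
  rintro _ ⟨L, hL, rfl⟩
  exact h L hL

theorem rook_map_mem {M : Type*} [AddCommGroup M] [Module R M] {A : Finset V} {K : Finset J}
    {d : ℕ} {S : Submodule R M} (f : Chain R (V × J) →ₗ[R] M)
    (h : ∀ L, IsRookList A K d L → f (mono R L) ∈ S) {z : Chain R (V × J)}
    (hz : z ∈ rook R A K d) : f z ∈ S :=
  rook_induction (S := S.comap f) h hz

theorem rook_mono {A A' : Finset V} {K K' : Finset J} {d : ℕ} (hA : A ⊆ A') (hK : K ⊆ K') :
    rook R A K d ≤ rook R A' K' d :=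
  rook_induction fun _ h => mono_mem_rook
    { h with row_mem := fun x hx => hA (h.row_mem x hx), col_mem := fun x hx => hK (h.col_mem x hx) }

theorem del_eq_zero_of_mem_rook {A : Finset V} {K : Finset J} {d : ℕ} {z : Chain R (V × J)}
    {i : V} {j : J} (hz : z ∈ rook R A K d) (hi : i ∉ A ∨ j ∉ K) : del (i, j) z = 0 := by
  refine (Submodule.mem_bot R).1 (rook_map_mem (del (i, j)) (fun L hL => ?_) hz)
  refine (Submodule.mem_bot R).2 (del_mono_of_notMem fun h => ?_)
  exact hi.elim (fun hi => hi (hL.row_mem _ h)) (fun hj => hj (hL.col_mem _ h))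

variable [DecidableEq V] [DecidableEq J]

theorem vert_mul_mem_rook {A A' : Finset V} {K K' : Finset J} {d : ℕ} {z : Chain R (V × J)}
    {r : V} {q : J} (hz : z ∈ rook R A K d) (hr : r ∉ A) (hq : q ∉ K) (hA : insert r A ⊆ A')
    (hK : insert q K ⊆ K') : vert R (r, q) * z ∈ rook R A' K' (d + 1) := by
  refine rook_mono hA hK (rook_map_mem (LinearMap.mulLeft R (vert R (r, q))) (fun L hL => ?_) hz)
  rw [LinearMap.mulLeft_apply, ← mono_cons]
  refine mono_mem_rook ⟨by simp [hL.length_eq], ?_, ?_, ?_, ?_⟩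
  · refine List.nodup_cons.2 ⟨fun h => ?_, hL.row_nodup⟩
    obtain ⟨x, hx, rfl⟩ := List.mem_map.1 h
    exact hr (hL.row_mem x hx)
  · intro x hx
    rcases List.mem_cons.1 hx with rfl | hx
    · simp
    · exact mem_insert_of_mem (hL.row_mem x hx)
  · refine List.nodup_cons.2 ⟨fun h => ?_, hL.col_nodup⟩
    obtain ⟨x, hx, rfl⟩ := List.mem_map.1 h
    exact hq (hL.col_mem x hx)
  · intro x hx
    rcases List.mem_cons.1 hx with rfl | hx
    · simp
    · exact mem_insert_of_mem (hL.col_mem x hx)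

theorem del_mem_rook {A : Finset V} {K : Finset J} {d : ℕ} {z : Chain R (V × J)} (i : V) (q : J)
    (hz : z ∈ rook R A K (d + 1)) : del (i, q) z ∈ rook R (A.erase i) (K.erase q) d := by
  refine rook_map_mem (del (i, q)) (fun L hL => ?_) hz
  refine Submodule.span_le.2 ?_ (del_mono_mem (i, q) hL.nodup)
  rintro _ ⟨L', ⟨h, h', h1, h2⟩, rfl⟩
  have hs := hL.sublist h
  rw [hL.length_eq] at h'
  rw [Nat.succ_injective h'] at hs
  refine mono_mem_rook { hs with row_mem := fun x hx => ?_, col_mem := fun x hx => ?_ }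
  · refine mem_erase.2 ⟨fun e => h2 ?_, hs.row_mem x hx⟩
    rwa [← List.inj_on_of_nodup_map hL.row_nodup (h.subset hx) h1 e]
  · refine mem_erase.2 ⟨fun e => h2 ?_, hs.col_mem x hx⟩
    rwa [← List.inj_on_of_nodup_map hL.col_nodup (h.subset hx) h1 e]

/-- A simplex uses at most one square of column `q`, so the sum is exactly the part of `z` that
meets this column. -/
theorem sub_column_mem_rook {A : Finset V} {K : Finset J} {d : ℕ} {z : Chain R (V × J)} (q : J)
    (hz : z ∈ rook R A K d) :
    z - ∑ i ∈ A, vert R (i, q) * del (i, q) z ∈ rook R A (K.erase q) d := by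
  let f : Chain R (V × J) →ₗ[R] Chain R (V × J) :=
    LinearMap.id - ∑ i ∈ A, LinearMap.mulLeft R (vert R (i, q)) ∘ₗ del (i, q)
  suffices f z ∈ rook R A (K.erase q) d by simpa [f] using this
  refine rook_map_mem f (fun L hL => ?_) hz
  simp only [f, LinearMap.sub_apply, LinearMap.id_apply, LinearMap.sum_apply, LinearMap.comp_apply,
    LinearMap.mulLeft_apply]
  by_cases h : ∃ i, (i, q) ∈ L
  · obtain ⟨i, hi⟩ := h
    rw [sum_eq_single_of_mem i (hL.row_mem _ hi), vert_mul_del_mono_of_mem hi, sub_self]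
    · exact zero_mem _
    · intro i' _ hne
      rw [del_mono_of_notMem, mul_zero]
      intro h'
      exact hne (congrArg Prod.fst (List.inj_on_of_nodup_map hL.col_nodup h' hi rfl))
  · push Not at h
    rw [sum_eq_zero, sub_zero]
    · exact mono_mem_rook { hL with
        col_mem := fun x hx => mem_erase.2 ⟨fun e => h x.1 (e ▸ hx), hL.col_mem x hx⟩ }
    · intro i _
      rw [del_mono_of_notMem (h i), mul_zero]

theorem sub_row_mem_rook {A : Finset V} {K : Finset J} {d : ℕ} {z : Chain R (V × J)} (r : V)
    (hz : z ∈ rook R A K d) :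
    z - ∑ j ∈ K, vert R (r, j) * del (r, j) z ∈ rook R (A.erase r) K d := by
  let f : Chain R (V × J) →ₗ[R] Chain R (V × J) :=
    LinearMap.id - ∑ j ∈ K, LinearMap.mulLeft R (vert R (r, j)) ∘ₗ del (r, j)
  suffices f z ∈ rook R (A.erase r) K d by simpa [f] using this
  refine rook_map_mem f (fun L hL => ?_) hz
  simp only [f, LinearMap.sub_apply, LinearMap.id_apply, LinearMap.sum_apply, LinearMap.comp_apply,
    LinearMap.mulLeft_apply]
  by_cases h : ∃ j, (r, j) ∈ L
  · obtain ⟨j, hj⟩ := h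
    rw [sum_eq_single_of_mem j (hL.col_mem _ hj), vert_mul_del_mono_of_mem hj, sub_self]
    · exact zero_mem _
    · intro j' _ hne
      rw [del_mono_of_notMem, mul_zero]
      intro h'
      exact hne (congrArg Prod.snd (List.inj_on_of_nodup_map hL.row_nodup h' hj rfl))
  · push Not at h
    rw [sum_eq_zero, sub_zero]
    · exact mono_mem_rook { hL with
        row_mem := fun x hx => mem_erase.2 ⟨fun e => h x.2 (e ▸ hx), hL.row_mem x hx⟩ }
    · intro j _
      rw [del_mono_of_notMem (h j), mul_zero]

/-- The chessboard complex with at least `d + 1` rows and at least `2 * d + 1` columns has no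
reduced homology in the degree of the simplices with `d` vertices. -/
theorem exists_bd_eq_of_mem_rook (d : ℕ) (A : Finset V) (K : Finset J) (hA : d + 1 ≤ #A)
    (hK : 2 * d + 1 ≤ #K) (z : Chain R (V × J)) (hz : z ∈ rook R A K d) (hbd : bd z = 0) :
    ∃ w ∈ rook R A K (d + 1), bd w = z := by
  induction d generalizing A K z with
  | zero =>
    obtain ⟨r, hr⟩ := card_pos.1 (by omega : 0 < #A)
    obtain ⟨q, hq⟩ := card_pos.1 (by omega : 0 < #K)
    refine ⟨vert R (r, q) * z, ?_, by rw [bd_vert_mul, hbd, mul_zero, sub_zero]⟩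
    have hz' : z ∈ rook R (∅ : Finset V) (∅ : Finset J) 0 :=
      rook_induction (fun L hL => mono_mem_rook ⟨hL.length_eq, hL.row_nodup,
        by simp [List.length_eq_zero_iff.1 hL.length_eq], hL.col_nodup,
        by simp [List.length_eq_zero_iff.1 hL.length_eq]⟩) hz
    exact vert_mul_mem_rook hz' (notMem_empty r) (notMem_empty q) (by simpa) (by simpa)
  | succ d ih =>
    obtain ⟨r, hr⟩ := card_pos.1 (by omega : 0 < #A)
    obtain ⟨q, hq⟩ := card_pos.1 (by omega : 0 < #K)
    -- Clearing column `q` outside row `r`: the link of `(i, q)` in `z` is a cycle on the board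
    -- without that row and column, so it bounds some `c i` by induction. Adding the boundary of
    -- `vert R (i, q) * c i` removes `(i, q)` from `z`.
    have hc (i : V) : ∃ c, i ∈ A.erase r →
        c ∈ rook R (A.erase i) (K.erase q) (d + 1) ∧ bd c = del (i, q) z := by
      by_cases hi : i ∈ A.erase r
      · obtain ⟨c, hc⟩ := ih (A.erase i) (K.erase q)
          (by rw [card_erase_of_mem (mem_of_mem_erase hi)]; omega)
          (by rw [card_erase_of_mem hq]; omega) (del (i, q) z) (del_mem_rook i q hz)
          (by rw [← neg_eq_zero, ← del_bd, hbd, map_zero])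
        exact ⟨c, fun _ => hc⟩
      · exact ⟨0, fun h => absurd h hi⟩
    choose c hc using hc
    set w₁ := ∑ i ∈ A.erase r, vert R (i, q) * c i with hw₁
    have hw₁m : w₁ ∈ rook R A K (d + 2) := sum_mem fun i hi =>
      vert_mul_mem_rook (hc i hi).1 (notMem_erase _ _) (notMem_erase _ _)
        (insert_erase (mem_of_mem_erase hi)).subset (insert_erase hq).subset
    set a := del (r, q) z with ha
    have ham : a ∈ rook R (A.erase r) (K.erase q) d := del_mem_rook r q hz
    set b := z - ∑ i ∈ A, vert R (i, q) * del (i, q) z + ∑ i ∈ A.erase r, c i with hb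
    have hbm : b ∈ rook R A (K.erase q) (d + 1) := by
      refine add_mem (sub_column_mem_rook q hz) (sum_mem fun i hi => ?_)
      exact rook_mono (erase_subset _ _) Subset.rfl (hc i hi).1
    have hz₁ : z + bd w₁ = vert R (r, q) * a + b := by
      have : bd w₁ = ∑ i ∈ A.erase r, c i - ∑ i ∈ A.erase r, vert R (i, q) * del (i, q) z := by
        rw [hw₁, map_sum, ← sum_sub_distrib]
        exact sum_congr rfl fun i hi => by rw [bd_vert_mul, (hc i hi).2]
      rw [this, hb, ← add_sum_erase A _ hr]
      abel
    -- Clearing row `r` of `b` in the same way. The links now avoid one row and two columns, which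
    -- is why each dimension costs two columns.
    have hc' (j : J) : ∃ c, j ∈ K.erase q →
        c ∈ rook R (A.erase r) ((K.erase q).erase j) (d + 1) ∧ bd c = del (r, j) b := by
      by_cases hj : j ∈ K.erase q
      · obtain ⟨c, hc⟩ := ih (A.erase r) ((K.erase q).erase j)
          (by rw [card_erase_of_mem hr]; omega)
          (by rw [card_erase_of_mem hj, card_erase_of_mem hq]; omega) (del (r, j) b)
          (del_mem_rook r j hbm) (by
            have h1 : del (r, j) (vert R (r, q) * a) = 0 := by
              rw [del_vert_mul_of_ne (by simpa using ne_of_mem_erase hj),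
                del_eq_zero_of_mem_rook ham (Or.inl (notMem_erase _ _)), mul_zero, neg_zero]
            have h2 : del (r, j) b = del (r, j) (z + bd w₁) := by
              rw [hz₁, map_add (del (r, j)) (vert R (r, q) * a), h1, zero_add]
            rw [h2, ← neg_eq_zero, ← del_bd, map_add, hbd, bd_bd, add_zero, map_zero])
        exact ⟨c, fun _ => hc⟩
      · exact ⟨0, fun h => absurd h hj⟩
    choose c' hc' using hc'
    set w₂ := ∑ j ∈ K.erase q, vert R (r, j) * c' j with hw₂
    have hw₂m : w₂ ∈ rook R A K (d + 2) := sum_mem fun j hj =>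
      vert_mul_mem_rook (hc' j hj).1 (notMem_erase _ _) (notMem_erase _ _)
        (insert_erase hr).subset ((insert_erase hj).subset.trans (erase_subset _ _))
    set b' := b - ∑ j ∈ K.erase q, vert R (r, j) * del (r, j) b + ∑ j ∈ K.erase q, c' j with hb'
    have hbm' : b' ∈ rook R (A.erase r) (K.erase q) (d + 1) := by
      refine add_mem (sub_row_mem_rook r hbm) (sum_mem fun j hj => ?_)
      exact rook_mono Subset.rfl (erase_subset _ _) (hc' j hj).1
    have hz₂ : z + bd w₁ + bd w₂ = vert R (r, q) * a + b' := by
      have : bd w₂ = ∑ j ∈ K.erase q, c' j - ∑ j ∈ K.erase q, vert R (r, j) * del (r, j) b := by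
        rw [hw₂, map_sum, ← sum_sub_distrib]
        exact sum_congr rfl fun j hj => by rw [bd_vert_mul, (hc' j hj).2]
      rw [this, hb', hz₁]
      abel
    -- Since `a` and `b'` avoid row `r` and column `q`, the terms with and without `(r, q)` vanish
    -- separately. This gives `bd b' = -a`, so the remaining cycle is the boundary of the cone over
    -- `b'` with apex `(r, q)`.
    have hcyc : a - vert R (r, q) * bd a + bd b' = 0 := by
      rw [← bd_vert_mul, ← map_add, ← hz₂]
      simp [hbd]
    have h0 {e : Chain R (V × J)} {k : ℕ} (he : e ∈ rook R (A.erase r) (K.erase q) k) :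
        del (r, q) e = 0 := del_eq_zero_of_mem_rook he (Or.inl (notMem_erase _ _))
    have hbda : bd a = 0 := by
      have := congrArg (del (r, q)) hcyc
      rw [map_add, map_sub, h0 ham, del_vert_mul_self, del_bd, h0 ham, del_bd, h0 hbm'] at this
      simpa using this
    have hbdb : bd b' = -a := by
      rw [hbda, mul_zero, sub_zero] at hcyc
      exact eq_neg_of_add_eq_zero_right hcyc
    refine ⟨vert R (r, q) * b' - w₁ - w₂, sub_mem (sub_mem ?_ hw₁m) hw₂m, ?_⟩
    · exact vert_mul_mem_rook hbm' (notMem_erase _ _) (notMem_erase _ _) (insert_erase hr).subset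
        (insert_erase hq).subset
    · rw [map_sub, map_sub, bd_vert_mul, hbdb]
      have : z = vert R (r, q) * a + b' - bd w₁ - bd w₂ := by rw [← hz₂]; abel
      rw [this]
      noncomm_ring

end Chain

/-! ### Executions: renaming of nodes, reachability and termination -/

namespace AsyncLocal

namespace Config

variable {V Q C : Type*}

theorem ext_iff' {c c' : Config V Q C} : c = c' ↔ c.old = c'.old ∧ c.new = c'.new := by
  cases c; cases c'; simp

open Classical in
/-- The nodes of `P` that have not terminated. -/
noncomputable def active (P : Finset V) (c : Config V Q C) : Finset V :=
  P.filter fun v => ∃ q, c.new v = .run q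

theorem mem_active {P : Finset V} {c : Config V Q C} {v : V} :
    v ∈ c.active P ↔ v ∈ P ∧ ∃ q, c.new v = .run q := by
  classical
  simp [active]

theorem active_subset (P : Finset V) (c : Config V Q C) : c.active P ⊆ P :=
  fun _ h => (mem_active.1 h).1

theorem active_congr {P : Finset V} {c c' : Config V Q C} (h : ∀ v ∈ P, c.new v = c'.new v) :
    c.active P = c'.active P := by
  ext v
  rw [mem_active, mem_active]
  exact and_congr_right fun hv => by rw [h v hv]

theorem active_erase [DecidableEq V] (P : Finset V) (c : Config V Q C) (v : V) :
    c.active (P.erase v) = (c.active P).erase v := by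
  ext u
  simp only [mem_active, mem_erase]
  tauto

/-- Renaming the nodes of a configuration. -/
def relabel (φ : V ≃ V) (c : Config V Q C) : Config V Q C where
  old v := c.old (φ.symm v)
  new v := c.new (φ.symm v)

theorem active_relabel (φ : V ≃ V) (P : Finset V) (c : Config V Q C) :
    (c.relabel φ).active (P.map φ.toEmbedding) = (c.active P).map φ.toEmbedding := by
  ext v
  simp only [mem_active, relabel, mem_map_equiv]

end Config

namespace Algorithm

variable {V I Q C : Type*} [DecidableEq V]

theorem write_congr {c c' : Config V Q C} {B : Finset V} (hold : c.old = c'.old)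
    (hnew : ∀ v ∈ B, c.new v = c'.new v) : write c B = write c' B := by
  funext v
  by_cases hv : v ∈ B
  · simp [write, hv, hnew v hv]
  · simp [write, hv, hold]

theorem write_relabel (φ : V ≃ V) (c : Config V Q C) (B : Finset V) :
    write (c.relabel φ) (B.map φ.toEmbedding) = write c B ∘ φ.symm := by
  funext v
  simp [write, Config.relabel, mem_map_equiv]

variable [Fintype V] (A : Algorithm I Q C) (G : SimpleGraph V) [DecidableRel G.Adj]

@[simp] theorem step_old (c : Config V Q C) (B : Finset V) : (A.step G c B).old = write c B := rfl

theorem step_new_of_notMem {c : Config V Q C} {B : Finset V} {v : V} (hv : v ∉ B) :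
    (A.step G c B).new v = c.new v := by
  simp [step, hv]

theorem step_new_congr {c c' : Config V Q C} {B B' : Finset V} {v : V}
    (hw : write c B = write c' B') (hv : v ∈ B ↔ v ∈ B') (hnew : c.new v = c'.new v) :
    (A.step G c B).new v = (A.step G c' B').new v := by
  simp [step, hv, hw, hnew]

theorem step_new_of_term {c : Config V Q C} {B : Finset V} {v : V} {x : C}
    (hv : c.new v = .term x) : (A.step G c B).new v = .term x := by
  simp [step, hv]

theorem exec_new_of_term {ident : V → ℕ} {inp : V → I} {S : ℕ → Finset V} {t t' : ℕ} (h : t ≤ t')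
    {v : V} {x : C} (hv : (A.exec G ident inp S t).new v = .term x) :
    (A.exec G ident inp S t').new v = .term x := by
  induction t', h using Nat.le_induction with
  | base => exact hv
  | succ k _ ih => exact A.step_new_of_term G ih

theorem exec_congr {ident : V → ℕ} {inp : V → I} {S S' : ℕ → Finset V} {t : ℕ}
    (h : ∀ i < t, S i = S' i) : A.exec G ident inp S t = A.exec G ident inp S' t := by
  induction t with
  | zero => rfl
  | succ t ih =>
    simp only [exec]
    rw [ih fun i hi => h i (by omega), h t (by omega)]

theorem step_relabel (φ : G ≃g G) (c : Config V Q C) (B : Finset V) :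
    A.step G (c.relabel φ.toEquiv) (B.map φ.toEquiv.toEmbedding) =
      (A.step G c B).relabel φ.toEquiv := by
  refine Config.ext_iff'.2 ⟨write_relabel _ _ _, ?_⟩
  funext v
  have hN : (G.neighborFinset v).val.map (write (c.relabel φ.toEquiv)
      (B.map φ.toEquiv.toEmbedding)) =
      (G.neighborFinset (φ.toEquiv.symm v)).val.map (write c B) := by
    have : G.neighborFinset v =
        (G.neighborFinset (φ.toEquiv.symm v)).map φ.toEquiv.toEmbedding := by
      ext u
      rw [mem_map_equiv, SimpleGraph.mem_neighborFinset, SimpleGraph.mem_neighborFinset]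
      exact (φ.symm.map_adj_iff (v := v) (w := u)).symm
    rw [this, write_relabel, Finset.map_val, Multiset.map_map]
    exact Multiset.map_congr rfl fun u _ => congrArg _ (φ.toEquiv.symm_apply_apply u)
  simp only [step, hN]
  simp [Config.relabel, mem_map_equiv]

theorem exec_relabel (φ : G ≃g G) (ident : V → ℕ) (x : I) (S : ℕ → Finset V) (t : ℕ) :
    A.exec G (ident ∘ φ.toEquiv.symm) (fun _ => x) (fun i => (S i).map φ.toEquiv.toEmbedding) t =
      (A.exec G ident (fun _ => x) S t).relabel φ.toEquiv := by
  induction t with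
  | zero => rfl
  | succ t ih => rw [exec, ih, step_relabel, exec]

/-- The configurations that occur in executions with distinct identifiers in `{1, …, N}`. -/
def Reachable (N : ℕ) (inp : V → I) (c : Config V Q C) : Prop :=
  ∃ ident : V → ℕ, Function.Injective ident ∧ (∀ v, 1 ≤ ident v ∧ ident v ≤ N) ∧
    ∃ S t, c = A.exec G ident inp S t

variable {A G} {N : ℕ} {inp : V → I}

theorem reachable_start {ident : V → ℕ} (h : Function.Injective ident)
    (h' : ∀ v, 1 ≤ ident v ∧ ident v ≤ N) : A.Reachable G N inp (A.start ident inp) :=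
  ⟨ident, h, h', fun _ => ∅, 0, rfl⟩

theorem Reachable.step {c : Config V Q C} (h : A.Reachable G N inp c) (B : Finset V) :
    A.Reachable G N inp (A.step G c B) := by
  obtain ⟨ident, h1, h2, S, t, rfl⟩ := h
  refine ⟨ident, h1, h2, Function.update S t B, t + 1, ?_⟩
  rw [exec, exec_congr A G (S := Function.update S t B) (S' := S), Function.update_self]
  intro i hi
  exact Function.update_of_ne hi.ne _ _

/-- An automorphism carries the identifiers and the scheduling along; the common input is
unaffected. -/
theorem Reachable.relabel {c : Config V Q C} {x : I} (φ : G ≃g G)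
    (h : A.Reachable G N (fun _ => x) c) :
    A.Reachable G N (fun _ => x) (c.relabel φ.toEquiv) := by
  obtain ⟨ident, h1, h2, S, t, rfl⟩ := h
  exact ⟨_, h1.comp φ.toEquiv.symm.injective, fun v => h2 _, _, t,
    (A.exec_relabel G φ ident x S t).symm⟩

variable (A G N inp)

/-- One step from a reachable configuration, in which only nodes that have not terminated are
activated. -/
def ActiveStep (c' c : Config V Q C) : Prop :=
  A.Reachable G N inp c ∧ ∃ B : Finset V, B.Nonempty ∧ B ⊆ c.active univ ∧ c' = A.step G c B

variable {A G N inp}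

/-- In an infinite sequence of such steps, some node would be activated infinitely often by the
pigeonhole principle. It would then have to terminate, yet it is still running whenever it is
activated. This is what permits recursion over executions with no bound on their length. -/
theorem SolvesColoring.wellFounded (hA : A.SolvesColoring G N inp) :
    WellFounded (A.ActiveStep G N inp) := by
  rw [wellFounded_iff_isEmpty_descending_chain]
  refine ⟨fun ⟨f, hf⟩ => ?_⟩
  obtain ⟨ident, h1, h2, S, t, h0⟩ := (hf 0).1
  choose B hne hB hstep using fun n => (hf n).2
  -- The scheduling that reaches `f 0` in `t` steps and then follows the infinite chain.
  let S' : ℕ → Finset V := fun i => if i < t then S i else B (i - t)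
  have hexec (n : ℕ) : A.exec G ident inp S' (t + n) = f n := by
    induction n with
    | zero =>
      rw [h0, add_zero]
      exact exec_congr A G fun i hi => by simp [S', hi]
    | succ n ih =>
      rw [← add_assoc, exec, ih, hstep n]
      simp [S']
  choose v hv using hne
  obtain ⟨u, hu⟩ := Finite.exists_infinite_fiber v
  have hu' : (v ⁻¹' {u}).Infinite := Set.infinite_coe_iff.1 hu
  obtain ⟨x, t₁, hx⟩ := (hA ident h1 h2 S').1 u fun t₁ => by
    obtain ⟨n, hn, hlt⟩ := hu'.exists_gt t₁
    refine ⟨t + n, by omega, ?_⟩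
    have : v n = u := hn
    simpa [S', ← this] using hv n
  obtain ⟨n, hn, hlt⟩ := hu'.exists_gt t₁
  have hx' := A.exec_new_of_term G (by omega : t₁ ≤ t + n) hx
  obtain ⟨q, hq⟩ := (Config.mem_active.1 (hB n (hv n))).2
  have : v n = u := hn
  rw [this, ← hexec n, hx'] at hq
  simp at hq

end Algorithm

end AsyncLocal

/-! ### Signed sums over executions -/

namespace AsyncLocal.Algorithm

variable {V I Q C : Type*} [DecidableEq V] [Fintype V] {A : Algorithm I Q C} {G : SimpleGraph V}
  [DecidableRel G.Adj] {N : ℕ} {inp : V → I} {W W' : Type*} [AddCommGroup W] [AddCommGroup W']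

open Classical in
/-- The sum of the values of `ψ` at the final configurations of all executions from `c` in which
only the nodes of `P` are activated, until all of them terminate. An execution is counted
with the sign `∏ (-1) ^ (#B + 1)` over its blocks `B` of simultaneously activated nodes. -/
noncomputable def execSum (hA : A.SolvesColoring G N inp) (ψ : Config V Q C → W) (P : Finset V) :
    Config V Q C → W :=
  hA.wellFounded.fix fun c rec =>
    if c.active P = ∅ then ψ c
    else ∑ B ∈ (c.active P).powerset.erase ∅,
      if h : A.Reachable G N inp c ∧ B.Nonempty ∧ B ⊆ c.active univ then
        (-1 : ℤ) ^ (#B + 1) • rec (A.step G c B) ⟨h.1, B, h.2.1, h.2.2, rfl⟩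
      else 0

variable (hA : A.SolvesColoring G N inp) {ψ : Config V Q C → W} {P : Finset V} {c : Config V Q C}

theorem execSum_of_active_eq_empty (h : c.active P = ∅) : execSum hA ψ P c = ψ c := by
  rw [execSum, WellFounded.fix_eq, if_pos h]

theorem active_subset_active_univ (P : Finset V) (c : Config V Q C) :
    c.active P ⊆ c.active univ := fun _ h =>
  Config.mem_active.2 ⟨mem_univ _, (Config.mem_active.1 h).2⟩

theorem execSum_of_active_ne_empty (hc : A.Reachable G N inp c) (h : c.active P ≠ ∅) :
    execSum hA ψ P c = ∑ B ∈ (c.active P).powerset.erase ∅,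
      (-1 : ℤ) ^ (#B + 1) • execSum hA ψ P (A.step G c B) := by
  rw [execSum, WellFounded.fix_eq, if_neg h]
  refine sum_congr rfl fun B hB => ?_
  rw [mem_erase, mem_powerset] at hB
  rw [dif_pos ⟨hc, nonempty_iff_ne_empty.2 hB.1, hB.2.trans (active_subset_active_univ P c)⟩]

theorem activeStep_of_mem (hc : A.Reachable G N inp c) {B : Finset V}
    (hB : B ∈ (c.active P).powerset.erase ∅) : A.ActiveStep G N inp (A.step G c B) c := by
  rw [mem_erase, mem_powerset] at hB
  exact ⟨hc, B, nonempty_iff_ne_empty.2 hB.1, hB.2.trans (active_subset_active_univ P c), rfl⟩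

theorem map_execSum (f : W →+ W') (hc : A.Reachable G N inp c) :
    f (execSum hA ψ P c) = execSum hA (fun c => f (ψ c)) P c := by
  induction c using hA.wellFounded.induction with
  | _ c ih =>
    by_cases h : c.active P = ∅
    · rw [execSum_of_active_eq_empty hA h, execSum_of_active_eq_empty hA h]
    · rw [execSum_of_active_ne_empty hA hc h, execSum_of_active_ne_empty hA hc h, map_sum]
      refine sum_congr rfl fun B hB => ?_
      rw [map_zsmul, ih _ (activeStep_of_mem hc hB) (hc.step B)]

theorem execSum_mem (S : AddSubgroup W) (hc : A.Reachable G N inp c)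
    (hψ : ∀ c, A.Reachable G N inp c → c.active P = ∅ → ψ c ∈ S) : execSum hA ψ P c ∈ S := by
  induction c using hA.wellFounded.induction with
  | _ c ih =>
    by_cases h : c.active P = ∅
    · rw [execSum_of_active_eq_empty hA h]
      exact hψ c hc h
    · rw [execSum_of_active_ne_empty hA hc h]
      exact sum_mem fun B hB => zsmul_mem (ih _ (activeStep_of_mem hc hB) (hc.step B)) _

/-- Nodes outside `P` are never activated again, so they matter only through their registers; their
unwritten states are invisible. -/
theorem execSum_congr (hψ : ∀ c c' : Config V Q C, (∀ v ∈ P, c.new v = c'.new v) → ψ c = ψ c')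
    {c' : Config V Q C} (hc : A.Reachable G N inp c) (hc' : A.Reachable G N inp c')
    (hold : c.old = c'.old) (hnew : ∀ v ∈ P, c.new v = c'.new v) :
    execSum hA ψ P c = execSum hA ψ P c' := by
  induction c using hA.wellFounded.induction generalizing c' with
  | _ c ih =>
    have hact := Config.active_congr hnew
    by_cases h : c.active P = ∅
    · rw [execSum_of_active_eq_empty hA h, execSum_of_active_eq_empty hA (hact ▸ h)]
      exact hψ c c' hnew
    · rw [execSum_of_active_ne_empty hA hc h, execSum_of_active_ne_empty hA hc' (hact ▸ h), ← hact]
      refine sum_congr rfl fun B hB => ?_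
      have hBP : B ⊆ P := (mem_powerset.1 (mem_of_mem_erase hB)).trans (c.active_subset P)
      have hw := write_congr hold fun v hv => hnew v (hBP hv)
      rw [ih _ (activeStep_of_mem hc hB) (hc.step B) (hc'.step B) hw
        fun v hv => A.step_new_congr G hw Iff.rfl (hnew v hv)]

theorem sum_powerset_insert_erase_empty {f : Finset V → W} {v : V} {s : Finset V} (hv : v ∉ s) :
    ∑ B ∈ (insert v s).powerset.erase ∅, f B =
      ∑ B ∈ s.powerset.erase ∅, f B + (f {v} + ∑ B ∈ s.powerset.erase ∅, f (insert v B)) := by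
  have h1 := sum_powerset_insert hv f
  rw [← add_sum_erase _ f (empty_mem_powerset (insert v s)),
    ← add_sum_erase _ f (empty_mem_powerset s),
    ← add_sum_erase _ (fun B => f (insert v B)) (empty_mem_powerset s)] at h1
  rw [add_assoc] at h1
  exact add_left_cancel h1

/-- This is why the nodes of `B` cannot tell whether `v` acted just before them or together with
them; only what `v` itself reads can differ. -/
theorem write_step_singleton {v : V} {B : Finset V} (hv : v ∉ B) :
    write (A.step G c {v}) B = write c (insert v B) := by
  funext u
  by_cases hu : u = v
  · subst hu
    simp [write, hv]
  · by_cases huB : u ∈ B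
    · have : (A.step G c {v}).new u = c.new u := A.step_new_of_notMem G (by simpa using hu)
      simp [write, huB, this]
    · simp [write, huB, hu]

/-- Executions that differ only in whether a block `B` comes after or together with a last
step of `v` cancel out, if `ψ` ignores `v`. -/
theorem execSum_erase {v : V}
    (hψ : ∀ c c' : Config V Q C, (∀ u ∈ P.erase v, c.new u = c'.new u) → ψ c = ψ c')
    (hc : A.Reachable G N inp c) :
    execSum hA ψ P c = execSum hA ψ (P.erase v) c := by
  induction c using hA.wellFounded.induction with
  | _ c ih =>
    have hact := c.active_erase P v
    by_cases hv : v ∈ c.active P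
    · have hne : c.active P ≠ ∅ := ne_empty_of_mem hv
      have hstep : ∀ u ∈ P.erase v, (A.step G c {v}).new u = c.new u := fun u hu =>
        A.step_new_of_notMem G (by simpa using ne_of_mem_erase hu)
      -- After the first block, the induction hypothesis removes `v` from the rest of the execution;
      -- only the position of `v` in the first block remains to be treated.
      rw [execSum_of_active_ne_empty hA hc hne, sum_congr rfl fun B hB => by
        rw [ih _ (activeStep_of_mem hc hB) (hc.step B)]]
      rw [← insert_erase hv, sum_powerset_insert_erase_empty (notMem_erase _ _), ← hact]
      have hact' : (A.step G c {v}).active (P.erase v) = c.active (P.erase v) :=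
        Config.active_congr hstep
      by_cases h : c.active (P.erase v) = ∅
      · rw [execSum_of_active_eq_empty hA h, h, execSum_of_active_eq_empty hA (hact'.trans h),
          hψ _ c hstep]
        simp
      -- The blocks without `v` already give the right-hand side. The block `{v}`, of sign `1`, is
      -- expanded by the next block `B` and cancels the terms of `insert v B`, whose sign is
      -- opposite to that of `B`.
      · rw [execSum_of_active_ne_empty hA hc h, add_eq_left,
          execSum_of_active_ne_empty hA (hc.step _) (by rwa [hact']), hact', card_singleton,
          Even.neg_one_pow ⟨1, rfl⟩, one_smul, ← sum_add_distrib]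
        refine sum_eq_zero fun B hB => ?_
        have hBP : B ⊆ P.erase v :=
          (mem_powerset.1 (mem_of_mem_erase hB)).trans (c.active_subset _)
        have hvB : v ∉ B := fun h => notMem_erase _ _ (hBP h)
        have hw := write_step_singleton (A := A) (G := G) (c := c) hvB
        rw [execSum_congr hA hψ ((hc.step {v}).step B) (hc.step (insert v B)) hw fun u hu =>
          A.step_new_congr G hw (by simp [ne_of_mem_erase hu]) (hstep u hu),
          card_insert_of_notMem hvB, pow_succ _ (#B + 1)]
        simp
    · rw [erase_eq_of_notMem hv] at hact
      by_cases h : c.active P = ∅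
      · rw [execSum_of_active_eq_empty hA h, execSum_of_active_eq_empty hA (hact.trans h)]
      · rw [execSum_of_active_ne_empty hA hc h, execSum_of_active_ne_empty hA hc (by rwa [hact]),
          hact]
        exact sum_congr rfl fun B hB => by rw [ih _ (activeStep_of_mem hc hB) (hc.step B)]

theorem execSum_subset {P' : Finset V} (hP : P' ⊆ P)
    (hψ : ∀ c c' : Config V Q C, (∀ u ∈ P', c.new u = c'.new u) → ψ c = ψ c')
    (hc : A.Reachable G N inp c) :
    execSum hA ψ P c = execSum hA ψ P' c := by
  induction P using Finset.strongInduction with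
  | H P ih =>
    by_cases h : P' = P
    · rw [h]
    · obtain ⟨v, hv, hv'⟩ := exists_of_ssubset (hP.ssubset_of_ne h)
      have hsub : P' ⊆ P.erase v := subset_erase.2 ⟨hP, hv'⟩
      rw [execSum_erase hA (v := v) (fun c c' h => hψ c c' fun u hu => h u (hsub hu)) hc,
        ih _ (erase_ssubset hv) hsub]

theorem execSum_relabel {x : I} (hA : A.SolvesColoring G N fun _ => x) (φ : G ≃g G)
    {ψ' : Config V Q C → W} (hψ : ∀ c, ψ' (c.relabel φ.toEquiv) = ψ c)
    (hc : A.Reachable G N (fun _ => x) c) :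
    execSum hA ψ' (P.map φ.toEquiv.toEmbedding) (c.relabel φ.toEquiv) = execSum hA ψ P c := by
  induction c using hA.wellFounded.induction with
  | _ c ih =>
    have hact := c.active_relabel φ.toEquiv P
    by_cases h : c.active P = ∅
    · rw [execSum_of_active_eq_empty hA h, execSum_of_active_eq_empty hA (by simp [hact, h]), hψ]
    · rw [execSum_of_active_ne_empty hA hc h,
        execSum_of_active_ne_empty hA (hc.relabel φ) (by simpa [hact] using h), hact]
      refine (sum_bij (fun B _ => B.map φ.toEquiv.toEmbedding) (fun B hB => ?_)
        (fun B _ B' _ h => map_injective _ h) (fun B hB => ?_) fun B hB => ?_).symm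
      · simpa [mem_erase, mem_powerset] using hB
      · rw [mem_erase, mem_powerset] at hB
        obtain ⟨B', hB', rfl⟩ := subset_map_iff.1 hB.2
        exact ⟨B', by simpa [mem_erase, mem_powerset, hB'] using hB.1, rfl⟩
      · rw [step_relabel, card_map, ih _ (activeStep_of_mem hc hB) (hc.step B)]

end AsyncLocal.Algorithm

/-! ### The equivariant chain map induced by an algorithm -/

namespace Chain

variable {R X : Type*} [CommRing R] {V J : Type*}

theorem eq_of_mem_rook {M : Type*} [AddCommGroup M] [Module R M] {A : Finset V} {K : Finset J}
    {d : ℕ} {f g : Chain R (V × J) →ₗ[R] M}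
    (h : ∀ L, IsRookList A K d L → f (mono R L) = g (mono R L)) {z : Chain R (V × J)}
    (hz : z ∈ rook R A K d) : f z = g z := by
  refine LinearMap.eqOn_span (s := mono R '' {L | IsRookList A K d L}) ?_ hz
  rintro _ ⟨L, hL, rfl⟩
  exact h L hL

variable [DecidableEq X]

/-- The projection to the chains whose simplices contain exactly those vertices of the list that
lie in `s`. -/
noncomputable def proj (R : Type*) [CommRing R] (s : Finset X) : List X → Chain R X →ₗ[R] Chain R X
  | [] => LinearMap.id
  | x :: l =>
    (if x ∈ s then LinearMap.mulLeft R (vert R x) ∘ₗ del x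
      else LinearMap.id - LinearMap.mulLeft R (vert R x) ∘ₗ del x) ∘ₗ proj R s l

theorem proj_mono (s : Finset X) (l L : List X) :
    proj R s l (mono R L) = if ∀ x ∈ l, (x ∈ s ↔ x ∈ L) then mono R L else 0 := by
  induction l with
  | nil => simp [proj]
  | cons x l ih =>
    rw [proj, LinearMap.comp_apply, ih]
    by_cases h : ∀ x ∈ l, (x ∈ s ↔ x ∈ L)
    · rw [if_pos h]
      simp only [List.forall_mem_cons]
      by_cases hs : x ∈ s <;> by_cases hL : x ∈ L <;>
        simp [hs, hL, vert_mul_del_mono_of_mem, del_mono_of_notMem, if_pos h]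
    · rw [if_neg h, map_zero, if_neg]
      simp only [List.forall_mem_cons]
      tauto

theorem proj_univ_mono [Fintype X] (s : Finset X) (L : List X) :
    proj R s (univ : Finset X).toList (mono R L) = if s = L.toFinset then mono R L else 0 := by
  rw [proj_mono]
  congr 1
  simp [Finset.ext_iff]

end Chain

namespace AsyncLocal

open Chain

/-- The vertex `lab v x` for the output `x` of `v`. -/
def Config.outVert {V Q C : Type*} (lab : V → C → V) (c : Config V Q C) (v : V) : V :=
  match c.new v with
  -- A default value, not attained by participating nodes at the end of an execution; the choice `v`
  -- keeps the definition equivariant.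
  | .run _ => v
  | .term x => lab v x

namespace Algorithm

variable {V I Q C : Type*} [DecidableEq V] [Fintype V] {A : Algorithm I Q C} {G : SimpleGraph V}
  [DecidableRel G.Adj] {N : ℕ} {inp : V → I}

/-- An assignment of identifiers in `{1, …, N}` that extends a placement of rooks. -/
structure IsIdent (s : Finset (V × Fin N)) (ident : V → ℕ) : Prop where
  injective : Function.Injective ident
  range : ∀ v, 1 ≤ ident v ∧ ident v ≤ N
  eq_of_mem : ∀ x ∈ s, ident x.1 = x.2 + 1

theorem IsIdent.subset {s t : Finset (V × Fin N)} {ident : V → ℕ} (h : IsIdent t ident)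
    (hs : s ⊆ t) : IsIdent s ident :=
  { h with eq_of_mem := fun x hx => h.eq_of_mem x (hs hx) }

theorem exists_isIdent {d : ℕ} {L : List (V × Fin N)}
    (hL : IsRookList (univ : Finset V) (univ : Finset (Fin N)) d L) (hN : Fintype.card V ≤ N) :
    ∃ ident : V → ℕ, IsIdent L.toFinset ident := by
  classical
  rcases isEmpty_or_nonempty V with hV | ⟨⟨v₀⟩⟩
  · exact ⟨fun _ => 1, fun v => hV.elim v, fun v => hV.elim v, fun x => hV.elim x.1⟩
  have hpos : 0 < N := (Fintype.card_pos_iff.2 ⟨v₀⟩).trans_le hN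
  let f : V → Fin N := fun v => if h : ∃ j, (v, j) ∈ L then h.choose else ⟨0, hpos⟩
  have hf : ∀ x ∈ L, f x.1 = x.2 := fun x hx => by
    have h : ∃ j, (x.1, j) ∈ L := ⟨x.2, hx⟩
    simp only [f, dif_pos h]
    exact congrArg Prod.snd (List.inj_on_of_nodup_map hL.row_nodup h.choose_spec hx rfl)
  let s : Finset V := L.toFinset.image Prod.fst
  have hinj : Set.InjOn f s := by
    intro v hv w hw h
    simp only [s, coe_image, Set.mem_image, List.coe_toFinset, Set.mem_ofPred_eq] at hv hw
    obtain ⟨x, hx, rfl⟩ := hv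
    obtain ⟨y, hy, rfl⟩ := hw
    rw [hf x hx, hf y hy] at h
    rw [List.inj_on_of_nodup_map hL.col_nodup hx hy h]
  -- The identifiers in use are enlarged to a set of exactly `Fintype.card V` of them, onto which
  -- the partial injection extends to a bijection.
  obtain ⟨t, hst, -, ht⟩ := Finset.exists_subsuperset_card_eq (subset_univ (s.image f))
    (n := Fintype.card V) (card_image_le.trans (card_le_univ _)) (by simpa using hN)
  obtain ⟨g, hg⟩ := Finset.exists_equiv_extend_of_card_eq ht.symm hst hinj
  refine ⟨fun v => (g v : Fin N) + 1, ?_, fun v => ⟨by omega, (g v : Fin N).2⟩, fun x hx => ?_⟩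
  · intro v w h
    exact g.injective (Subtype.ext (Fin.ext (by simpa using h)))
  · have hx' := List.mem_toFinset.1 hx
    rw [hg x.1 (mem_image_of_mem _ hx), hf x hx']

variable (R : Type*) [CommRing R] (hA : A.SolvesColoring G N inp) (lab : V → C → V)

/-- The signed sum, over all executions in which exactly the nodes of `P` participate, of the maps
of chains that replace the identifiers by the outputs. -/
noncomputable def execMap (P : Finset V) (c : Config V Q C) :
    Chain R (V × Fin N) →ₗ[R] Chain R V :=
  execSum hA (fun c => (chmap R fun x : V × Fin N => c.outVert lab x.1).toLinearMap) P c

variable {R}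

/-- The evaluation of linear maps at a vector, as a homomorphism. -/
def evalAddHom {M M' : Type*} [AddCommGroup M] [AddCommGroup M'] [Module R M] [Module R M']
    (w : M) : (M →ₗ[R] M') →+ M' where
  toFun f := f w
  map_zero' := rfl
  map_add' _ _ := rfl

theorem execMap_mono {c : Config V Q C} (hc : A.Reachable G N inp c) (P : Finset V)
    (L : List (V × Fin N)) : execMap R hA lab P c (mono R L) =
      execSum hA (fun c => mono R (L.map fun x => c.outVert lab x.1)) P c := by
  have := map_execSum hA (evalAddHom (mono R L)) (P := P)
    (ψ := fun c : Config V Q C => (chmap R fun x : V × Fin N => c.outVert lab x.1).toLinearMap) hc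
  refine this.trans ?_
  congr 1
  funext c
  exact chmap_mono _ _

theorem bd_execMap {c : Config V Q C} (hc : A.Reachable G N inp c) (P : Finset V)
    (z : Chain R (V × Fin N)) : bd (execMap R hA lab P c z) = execMap R hA lab P c (bd z) := by
  have h1 := map_execSum hA ((bd (R := R) (X := V)).toAddMonoidHom.comp (evalAddHom z)) (P := P)
    (ψ := fun c : Config V Q C => (chmap R fun x : V × Fin N => c.outVert lab x.1).toLinearMap) hc
  have h2 := map_execSum hA (evalAddHom (bd z)) (P := P)
    (ψ := fun c : Config V Q C => (chmap R fun x : V × Fin N => c.outVert lab x.1).toLinearMap) hc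
  refine h1.trans (Eq.trans ?_ h2.symm)
  congr 1
  funext c
  exact bd_chmap _ _

theorem mono_outVert_congr {P : Finset V} {L : List (V × Fin N)} (h : ∀ x ∈ L, x.1 ∈ P)
    (c c' : Config V Q C) (hc : ∀ v ∈ P, c.new v = c'.new v) :
    mono R (L.map fun x => c.outVert lab x.1) = mono R (L.map fun x => c'.outVert lab x.1) := by
  congr 1
  exact List.map_congr_left fun x hx => by simp only [Config.outVert, hc x.1 (h x hx)]

/-- The rows occupied by a list of squares. -/
def rows (L : List (V × Fin N)) : Finset V := L.toFinset.image Prod.fst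

theorem mem_rows {L : List (V × Fin N)} {x : V × Fin N} (hx : x ∈ L) : x.1 ∈ rows L :=
  mem_image_of_mem _ (List.mem_toFinset.2 hx)

theorem rows_subset {L : List (V × Fin N)} {P : Finset V} (h : ∀ x ∈ L, x.1 ∈ P) :
    rows L ⊆ P := by
  intro v hv
  obtain ⟨x, hx, rfl⟩ := mem_image.1 hv
  exact h x (List.mem_toFinset.1 hx)

theorem execMap_mono_rows {c : Config V Q C} (hc : A.Reachable G N inp c) {P : Finset V}
    {L : List (V × Fin N)} (h : ∀ x ∈ L, x.1 ∈ P) :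
    execMap R hA lab P c (mono R L) = execMap R hA lab (rows L) c (mono R L) := by
  rw [execMap_mono hA lab hc, execMap_mono hA lab hc]
  exact execSum_subset hA (rows_subset h)
    (mono_outVert_congr lab fun x hx => mem_rows hx) hc

/-- Initially all registers are empty, so the identifiers of nodes that never act are irrelevant.
Hence the choice of an extension in `outMap` does not matter. -/
theorem execMap_start_congr {L : List (V × Fin N)} {ident ident' : V → ℕ}
    (h : IsIdent L.toFinset ident) (h' : IsIdent L.toFinset ident') :
    execMap R hA lab (rows L) (A.start ident inp) (mono R L) =
      execMap R hA lab (rows L) (A.start ident' inp) (mono R L) := by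
  have hc := reachable_start (A := A) (G := G) (inp := inp) h.injective h.range
  have hc' := reachable_start (A := A) (G := G) (inp := inp) h'.injective h'.range
  rw [execMap_mono hA lab hc, execMap_mono hA lab hc']
  refine execSum_congr hA (mono_outVert_congr lab fun x hx => mem_rows hx) hc hc' rfl
    fun v hv => ?_
  obtain ⟨x, hx, rfl⟩ := mem_image.1 hv
  simp only [start, h.eq_of_mem x hx, h'.eq_of_mem x hx]

open Classical in
variable (R) in
/-- The map from the chains of the chessboard complex to chains on the set of nodes which an
algorithm induces. -/
noncomputable def outMap : Chain R (V × Fin N) →ₗ[R] Chain R V :=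
  ∑ s : Finset (V × Fin N),
    (if h : ∃ ident : V → ℕ, IsIdent s ident then
      execMap R hA lab (s.image Prod.fst) (A.start h.choose inp) else 0) ∘ₗ
    proj R s (univ : Finset (V × Fin N)).toList

theorem outMap_mono {L : List (V × Fin N)} {ident : V → ℕ} (h : IsIdent L.toFinset ident) :
    outMap R hA lab (mono R L) =
      execMap R hA lab (rows L) (A.start ident inp) (mono R L) := by
  classical
  have hex : ∃ ident : V → ℕ, IsIdent L.toFinset ident := ⟨ident, h⟩
  simp only [outMap, LinearMap.sum_apply, LinearMap.comp_apply]
  rw [sum_eq_single_of_mem L.toFinset (mem_univ _)]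
  · rw [dif_pos hex]
    have : proj R L.toFinset (univ : Finset (V × Fin N)).toList (mono R L) = mono R L := by
      rw [proj_univ_mono, if_pos rfl]
    exact (congrArg _ this).trans (execMap_start_congr (R := R) hA lab hex.choose_spec h)
  · intro s _ hs
    have : proj R s (univ : Finset (V × Fin N)).toList (mono R L) = 0 := by
      rw [proj_univ_mono, if_neg hs]
    exact (congrArg _ this).trans (map_zero _)

theorem outMap_one (hN : Fintype.card V ≤ N) : outMap R hA lab 1 = 1 := by
  obtain ⟨ident, h⟩ := exists_isIdent (V := V) (N := N) (L := [])
    ⟨rfl, List.nodup_nil, by simp, List.nodup_nil, by simp⟩ hN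
  have := outMap_mono (R := R) hA lab h
  rw [execMap_mono hA lab (reachable_start h.injective h.range), execSum_of_active_eq_empty] at this
  · simpa using this
  · simp [rows, Config.active]

/-- One assignment of identifiers serves a simplex and all its faces. For that fixed start the
execution sum commutes with `bd`, and on a face the absent nodes can be dropped from the executions
by `execMap_mono_rows`. -/
theorem bd_outMap {d : ℕ} (hN : Fintype.card V ≤ N) {z : Chain R (V × Fin N)}
    (hz : z ∈ rook R univ univ d) : bd (outMap R hA lab z) = outMap R hA lab (bd z) := by
  refine eq_of_mem_rook (f := bd ∘ₗ outMap R hA lab) (g := outMap R hA lab ∘ₗ bd)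
    (fun L hL => ?_) hz
  obtain ⟨ident, h⟩ := exists_isIdent hL hN
  have hc := reachable_start (A := A) (G := G) (inp := inp) h.injective h.range
  rw [LinearMap.comp_apply, LinearMap.comp_apply, outMap_mono hA lab h, bd_execMap hA lab hc]
  refine LinearMap.eqOn_span (s := mono R '' {L' | L'.Sublist L ∧ L'.length + 1 = L.length}) ?_
    (bd_mono_mem L)
  rintro _ ⟨L', ⟨hL', -⟩, rfl⟩
  rw [outMap_mono hA lab (h.subset fun x hx =>
    List.mem_toFinset.2 (hL'.subset (List.mem_toFinset.1 hx)))]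
  exact execMap_mono_rows hA lab hc fun x hx => mem_rows (hL'.subset hx)

theorem outMap_mem {d : ℕ} (hN : Fintype.card V ≤ N) {z : Chain R (V × Fin N)}
    (hz : z ∈ rook R univ univ d) {S : Submodule R (Chain R V)}
    (hS : ∀ L : List V, L.length = d → mono R L ∈ S) : outMap R hA lab z ∈ S := by
  refine rook_map_mem (outMap R hA lab) (fun L hL => ?_) hz
  obtain ⟨ident, h⟩ := exists_isIdent hL hN
  have hc := reachable_start (A := A) (G := G) (inp := inp) h.injective h.range
  rw [outMap_mono hA lab h, execMap_mono hA lab hc]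
  exact execSum_mem hA S.toAddSubgroup hc fun c _ _ => hS _ (by simp [hL.length_eq])

/-- With all nodes participating, each final configuration is a proper coloring, so `hlab` forces a
repeated vertex in the resulting monomial. -/
theorem outMap_eq_zero (hN : Fintype.card V ≤ N)
    (hlab : ∀ col : V → C, (∀ u v, G.Adj u v → col u ≠ col v) →
      ¬ Function.Injective fun v => lab v (col v))
    {z : Chain R (V × Fin N)} (hz : z ∈ rook R univ univ (Fintype.card V)) :
    outMap R hA lab z = 0 := by
  refine (Submodule.mem_bot R).1 (rook_map_mem (outMap R hA lab) (fun L hL => ?_) hz)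
  obtain ⟨ident, h⟩ := exists_isIdent hL hN
  have hc := reachable_start (A := A) (G := G) (inp := inp) h.injective h.range
  rw [outMap_mono hA lab h, execMap_mono hA lab hc]
  refine execSum_mem hA (⊥ : AddSubgroup (Chain R V)) hc fun c hc' hact => ?_
  rw [AddSubgroup.mem_bot]
  have hrows : rows L = univ := by
    rw [← card_eq_iff_eq_univ, ← hL.length_eq, ← List.length_map (f := Prod.fst),
      ← List.toFinset_card_of_nodup hL.row_nodup]
    congr 1
    ext v
    simp [rows]
  have hterm (v : V) : ∃ x, c.new v = .term x := by
    rcases hv : c.new v with q | x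
    · have : v ∈ c.active (rows L) := Config.mem_active.2 ⟨hrows ▸ mem_univ v, q, hv⟩
      simp [hact] at this
    · exact ⟨x, rfl⟩
  choose col hcol using hterm
  obtain ⟨ident', hi1, hi2, S, t, rfl⟩ := hc'
  refine mono_eq_zero_of_not_nodup fun hnd => hlab col (fun u v huv => ?_) fun u v huv => ?_
  · exact (hA ident' hi1 hi2 S).2 u v huv _ _ ⟨t, hcol u⟩ ⟨t, hcol v⟩
  · obtain ⟨x, hx, rfl⟩ := mem_image.1 (hrows ▸ mem_univ u : u ∈ rows L)
    obtain ⟨y, hy, rfl⟩ := mem_image.1 (hrows ▸ mem_univ v : v ∈ rows L)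
    rw [List.mem_toFinset] at hx hy
    rw [List.inj_on_of_nodup_map hnd hx hy]
    simpa [Config.outVert, hcol] using huv

theorem outMap_chmap {x₀ : I} (hA : A.SolvesColoring G N fun _ => x₀) {d : ℕ}
    (hN : Fintype.card V ≤ N) (φ : G ≃g G) (hφ : ∀ v x, lab (φ v) x = φ (lab v x))
    {z : Chain R (V × Fin N)} (hz : z ∈ rook R univ univ d) :
    outMap R hA lab (chmap R (Prod.map φ id) z) = chmap R φ (outMap R hA lab z) := by
  refine eq_of_mem_rook (f := outMap R hA lab ∘ₗ (chmap R (Prod.map φ id)).toLinearMap)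
    (g := (chmap R φ).toLinearMap ∘ₗ outMap R hA lab) (fun L hL => ?_) hz
  obtain ⟨ident, h⟩ := exists_isIdent hL hN
  have hc := reachable_start (A := A) (G := G) (inp := fun _ => x₀) h.injective h.range
  have h' : IsIdent (L.map (Prod.map φ id)).toFinset (ident ∘ φ.toEquiv.symm) := by
    refine ⟨h.injective.comp φ.toEquiv.symm.injective, fun v => h.range _, fun y hy => ?_⟩
    obtain ⟨x, hx, rfl⟩ := List.mem_map.1 (List.mem_toFinset.1 hy)
    exact (congrArg ident (φ.toEquiv.symm_apply_apply x.1)).trans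
      (h.eq_of_mem x (List.mem_toFinset.2 hx))
  have hrows : rows (L.map (Prod.map φ id)) = (rows L).map φ.toEquiv.toEmbedding := by
    ext v
    simp only [rows, mem_image, mem_map, List.mem_toFinset, List.mem_map]
    constructor
    · rintro ⟨_, ⟨x, hx, rfl⟩, rfl⟩
      exact ⟨x.1, ⟨x, hx, rfl⟩, rfl⟩
    · rintro ⟨_, ⟨x, hx, rfl⟩, rfl⟩
      exact ⟨_, ⟨x, hx, rfl⟩, rfl⟩
  simp only [LinearMap.comp_apply, AlgHom.toLinearMap_apply]
  rw [chmap_mono, outMap_mono hA lab h, outMap_mono hA lab h', hrows, execMap_mono hA lab hc,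
    show A.start (ident ∘ φ.toEquiv.symm) (fun _ => x₀) =
      (A.start ident fun _ => x₀).relabel φ.toEquiv from rfl,
    execMap_mono hA lab (hc.relabel φ)]
  refine (execSum_relabel hA φ (fun c => ?_) hc).trans
    (map_execSum hA (chmap R φ : Chain R V →+* Chain R V).toAddMonoidHom hc).symm
  change _ = chmap R φ _
  rw [chmap_mono, List.map_map, List.map_map]
  congr 1
  refine List.map_congr_left fun x _ => ?_
  have hv : φ.toEquiv.symm (φ x.1) = x.1 := φ.toEquiv.symm_apply_apply x.1
  simp only [Function.comp_apply, Prod.map_fst, Config.outVert, Config.relabel, hv]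
  split
  · rfl
  · exact hφ _ _

end Algorithm

end AsyncLocal

/-! ### Top-degree chains on the odd cycle -/

namespace Chain

variable {R X : Type*} [CommRing R]

/-- The chains spanned by the simplices with `d` vertices. -/
noncomputable def deg (R X : Type*) [CommRing R] (d : ℕ) : Submodule R (Chain R X) :=
  Submodule.span R (mono R '' {L | L.length = d})

theorem mono_mem_deg (L : List X) {d : ℕ} (h : L.length = d) : mono R L ∈ deg R X d :=
  Submodule.subset_span ⟨L, h, rfl⟩

theorem deg_map_mem {M : Type*} [AddCommGroup M] [Module R M] {d : ℕ} {S : Submodule R M}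
    (f : Chain R X →ₗ[R] M) (h : ∀ L : List X, L.length = d → f (mono R L) ∈ S) {z : Chain R X}
    (hz : z ∈ deg R X d) : f z ∈ S := by
  have : deg R X d ≤ S.comap f := by
    refine Submodule.span_le.2 ?_
    rintro _ ⟨L, hL, rfl⟩
    exact h L hL
  exact this hz

theorem eq_of_mem_deg {M : Type*} [AddCommGroup M] [Module R M] {d : ℕ}
    {f g : Chain R X →ₗ[R] M} (h : ∀ L : List X, L.length = d → f (mono R L) = g (mono R L))
    {z : Chain R X} (hz : z ∈ deg R X d) : f z = g z := by
  refine LinearMap.eqOn_span (s := mono R '' {L | L.length = d}) ?_ hz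
  rintro _ ⟨L, hL, rfl⟩
  exact h L hL

theorem vert_mul_mem_deg {d : ℕ} {z : Chain R X} (hz : z ∈ deg R X d) (x : X) :
    vert R x * z ∈ deg R X (d + 1) := by
  refine deg_map_mem (LinearMap.mulLeft R (vert R x)) (fun L hL => ?_) hz
  rw [LinearMap.mulLeft_apply, ← mono_cons]
  exact mono_mem_deg _ (by simp [hL])

theorem vert_mul_eq_zero_of_mem_deg_card [Fintype X] {z : Chain R X}
    (hz : z ∈ deg R X (Fintype.card X)) (x : X) : vert R x * z = 0 := by
  refine eq_of_mem_deg (f := LinearMap.mulLeft R (vert R x)) (g := 0) (fun L hL => ?_) hz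
  rw [LinearMap.mulLeft_apply, ← mono_cons]
  refine mono_eq_zero_of_not_nodup fun h => ?_
  have := h.length_le_card
  simp [hL] at this

/-- The cone over a top-degree chain is zero, so the cone formula recovers the chain from its
boundary. -/
theorem vert_mul_bd_of_mem_deg_card [Fintype X] {z : Chain R X}
    (hz : z ∈ deg R X (Fintype.card X)) (x : X) : vert R x * bd z = z := by
  have := bd_vert_mul x z
  rw [vert_mul_eq_zero_of_mem_deg_card hz, map_zero] at this
  exact (sub_eq_zero.1 this.symm).symm

theorem mono_ofFn {n : ℕ} (f : Fin n → X) :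
    mono R (List.ofFn f) = ExteriorAlgebra.ιMulti R n fun i => Finsupp.single (f i) 1 := by
  rw [ExteriorAlgebra.ιMulti_apply, mono, List.map_ofFn]
  rfl

/-- An even permutation of the vertices acts trivially on the chains of top degree. -/
theorem chmap_eq_self_of_mem_deg_card [Fintype X] [DecidableEq X] {z : Chain R X}
    (hz : z ∈ deg R X (Fintype.card X)) (σ : Equiv.Perm X) (hσ : Equiv.Perm.sign σ = 1) :
    chmap R σ z = z := by
  refine eq_of_mem_deg (f := (chmap R σ).toLinearMap) (g := LinearMap.id) (fun L hL => ?_) hz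
  simp only [AlgHom.toLinearMap_apply, chmap_mono, LinearMap.id_apply]
  by_cases h : L.Nodup
  · let f : Fin (Fintype.card X) → X := fun i => L.get (Fin.cast hL.symm i)
    have hf : Function.Injective f := fun i j hij =>
      Fin.cast_injective hL.symm (List.nodup_iff_injective_get.1 h hij)
    have hLf : L = List.ofFn f := by
      refine List.ext_get (by simp [hL]) fun i h1 h2 => ?_
      simp [f]
    let e : Fin (Fintype.card X) ≃ X :=
      Equiv.ofBijective f ((Fintype.bijective_iff_injective_and_card f).2 ⟨hf, by simp⟩)
    have hsign : Equiv.Perm.sign ((e.trans σ).trans e.symm) = 1 := by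
      rw [Equiv.Perm.sign_trans_trans_symm, hσ]
    have := (ExteriorAlgebra.ιMulti R (Fintype.card X)).map_perm
      (fun i => Finsupp.single (f i) (1 : R)) ((e.trans σ).trans e.symm)
    rw [hsign, one_smul] at this
    rw [hLf, List.map_ofFn, mono_ofFn, mono_ofFn, ← this]
    congr 1
    funext i
    change Finsupp.single (σ (e i)) (1 : R) = Finsupp.single (e (e.symm (σ (e i)))) 1
    rw [e.apply_symm_apply]
  · rw [mono_eq_zero_of_not_nodup h, mono_eq_zero_of_not_nodup fun h' => h h'.of_map]

variable {n : ℕ} [NeZero n]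

/-- The rotations of the cycle act on chains. -/
noncomputable def rot (R : Type*) [CommRing R] (i : Fin n) : Chain R (Fin n) →ₐ[R] Chain R (Fin n) :=
  chmap R (· + i)

theorem rot_vert (i v : Fin n) : rot R i (vert R v) = vert R (v + i) := chmap_vert _ _

/-- The `n`-th power of a rotation is trivial and `n` is odd, so a rotation is an even permutation.
-/
theorem rot_eq_self_of_mem_deg (hn : Odd n) {z : Chain R (Fin n)} (hz : z ∈ deg R (Fin n) n)
    (i : Fin n) : rot R i z = z := by
  refine chmap_eq_self_of_mem_deg_card (by simpa using hz) (Equiv.addRight i) ?_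
  have h1 : Equiv.addRight i ^ n = 1 := by
    have h : n • i = 0 := by simpa using card_nsmul_eq_zero' (x := i)
    exact Equiv.ext fun v => by simp [h]
  have h2 := congrArg Equiv.Perm.sign h1
  rw [map_pow, map_one] at h2
  rcases Int.units_eq_one_or (Equiv.Perm.sign (Equiv.addRight i)) with h | h
  · exact h
  · rw [h, hn.neg_one_pow] at h2
    exact absurd h2 (by decide)

/-- The sum of the edges of the oriented cycle. -/
noncomputable def cyc (R : Type*) [CommRing R] (n : ℕ) [NeZero n] : Chain R (Fin n) :=
  ∑ i : Fin n, vert R (i + 1) * vert R i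

theorem sum_add_right {M : Type*} [AddCommMonoid M] (f : Fin n → M) (k : Fin n) :
    ∑ i, f (i + k) = ∑ i, f i :=
  Equiv.sum_comp (Equiv.addRight k) f

theorem rot_cyc (k : Fin n) : rot R k (cyc R n) = cyc R n := by
  rw [cyc, map_sum, ← sum_add_right (fun i => vert R (i + 1) * vert R i) k]
  refine sum_congr rfl fun i _ => ?_
  rw [map_mul, rot_vert, rot_vert, add_right_comm]

/-- `cyc` has even degree, and its own boundary telescopes to zero around the cycle. -/
theorem bd_cyc_mul (a : Chain R (Fin n)) : bd (cyc R n * a) = cyc R n * bd a := by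
  rw [cyc, sum_mul, map_sum, sum_mul]
  simp only [bd_vert_mul_vert_mul]
  rw [sum_add_distrib, ← sum_mul, sum_sub_distrib, sum_add_right, sub_self, zero_mul, zero_add]

theorem bd_cyc_pow_mul (j : ℕ) (a : Chain R (Fin n)) :
    bd (cyc R n ^ j * a) = cyc R n ^ j * bd a := by
  induction j with
  | zero => simp
  | succ j ih => rw [pow_succ', mul_assoc, bd_cyc_mul, ih, mul_assoc]

theorem cyc_mul_mem_deg {d : ℕ} {z : Chain R (Fin n)} (hz : z ∈ deg R (Fin n) d) :
    cyc R n * z ∈ deg R (Fin n) (d + 2) := by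
  rw [cyc, sum_mul]
  refine sum_mem fun i _ => ?_
  rw [mul_assoc]
  exact vert_mul_mem_deg (vert_mul_mem_deg hz _) _

theorem cyc_pow_mul_mem_deg {d : ℕ} {z : Chain R (Fin n)} (hz : z ∈ deg R (Fin n) d) (j : ℕ) :
    cyc R n ^ j * z ∈ deg R (Fin n) (d + 2 * j) := by
  induction j with
  | zero => simpa
  | succ j ih =>
    rw [pow_succ', mul_assoc]
    exact cyc_mul_mem_deg ih

/-- If the orbit sum of a chain `Y` bounds a top-dimensional chain `Z`, and `Y` bounds the
difference of `X` and its rotation, then `Z` is the product of the cycle and `X`. -/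
theorem eq_cyc_mul_of_bd (hn : Odd n) (hR : (n : R) = 0) {d : ℕ} (hd : d + 2 = n)
    {X Y Z : Chain R (Fin n)} (hX : X ∈ deg R (Fin n) d) (hY : Y ∈ deg R (Fin n) (d + 1))
    (hZ : Z ∈ deg R (Fin n) n) (hbY : bd Y = X - rot R 1 X) (hbZ : bd Z = ∑ i, rot R i Y) :
    Z = cyc R n * X := by
  have hcard : Fintype.card (Fin n) = n := Fintype.card_fin n
  have hvY (i : Fin n) : vert R i * Y ∈ deg R (Fin n) n := by
    have := vert_mul_mem_deg hY i
    rwa [add_assoc, hd] at this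
  have hvX (i : Fin n) : vert R (i + 1) * (vert R i * X) ∈ deg R (Fin n) n :=
    by
      have := vert_mul_mem_deg (vert_mul_mem_deg hX i) (i + 1)
      rwa [add_assoc, hd] at this
  -- `Z` is the cone from `0` over its boundary; by invariance of top-degree chains, the cone from
  -- `0` over `rot R i Y` equals the cone from `-i` over `Y`.
  have hZ' : Z = ∑ i, vert R i * Y := by
    rw [← vert_mul_bd_of_mem_deg_card (z := Z) (by rwa [hcard]) 0, hbZ, mul_sum,
      ← Equiv.sum_comp (Equiv.neg (Fin n)) fun i => vert R i * Y]
    refine sum_congr rfl fun i _ => ?_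
    rw [← rot_eq_self_of_mem_deg hn (hvY (Equiv.neg (Fin n) i)) i, map_mul, rot_vert]
    simp
  -- The relation `bd Y = X - rot R 1 X`, coned off twice, shows that `k` is constant. Its sum is
  -- then `n` times a chain, hence zero in `R`, and this is the claimed identity.
  let k : Fin n → Chain R (Fin n) := fun i =>
    vert R (i + 1) * Y - vert R (i + 1) * (vert R i * X)
  have hk (i : Fin n) : k (i + 1) = k i := by
    have h1 : vert R (i + 1 + 1) * (vert R (i + 1) * bd Y) =
        vert R (i + 1 + 1) * Y - vert R (i + 1) * Y := by
      have h2 := bd_vert_mul (i + 1) Y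
      have h3 := vert_mul_bd_of_mem_deg_card (z := vert R (i + 1) * Y) (by simpa using hvY (i + 1))
        (i + 1 + 1)
      rw [h2, mul_sub] at h3
      rw [← h3]
      abel
    have h4 : vert R (i + 1 + 1) * (vert R (i + 1) * rot R 1 X) =
        vert R (i + 1) * (vert R i * X) := by
      rw [← rot_eq_self_of_mem_deg hn (hvX i) 1, map_mul, map_mul, rot_vert, rot_vert]
    rw [hbY, mul_sub, mul_sub, h4] at h1
    simp only [k]
    rw [sub_eq_sub_iff_sub_eq_sub, ← h1]
  have hk0 (j : ℕ) : k (Fin.ofNat n j) = k 0 := by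
    induction j with
    | zero => rfl
    | succ j ih =>
      rw [← ih, ← hk (Fin.ofNat n j)]
      congr 1
      simp [Fin.ext_iff, Fin.val_add]
  have hsum : ∑ i, k i = 0 := by
    rw [sum_congr rfl fun (i : Fin n) _ => (by simpa using hk0 i : k i = k 0), sum_const, card_univ,
      hcard, ← Nat.cast_smul_eq_nsmul R, hR, zero_smul]
  simp only [k] at hsum
  rw [sum_sub_distrib, sum_add_right fun i => vert R i * Y, sub_eq_zero] at hsum
  rw [hZ', hsum, cyc, sum_mul]
  simp only [mul_assoc]

/-- By rotation invariance in top degree, `cyc R n ^ m * vert R x` is the same for all `x`; only the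
sum of the coefficients of `y` counts. -/
theorem cyc_pow_mul_eq (hn : Odd n) {m : ℕ} (hm : 2 * m + 1 = n) {y : Chain R (Fin n)}
    (hy : y ∈ deg R (Fin n) 1) (hbd : bd y = 1) :
    cyc R n ^ m * y = cyc R n ^ m * vert R 0 := by
  have : LinearMap.mulLeft R (cyc R n ^ m) y =
      (LinearMap.mulLeft R (cyc R n ^ m * vert R 0) ∘ₗ bd) y := by
    refine eq_of_mem_deg (fun L hL => ?_) hy
    obtain ⟨x, rfl⟩ := List.length_eq_one_iff.1 hL
    have h0 : cyc R n ^ m * vert R 0 ∈ deg R (Fin n) n := by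
      have := cyc_pow_mul_mem_deg (mono_mem_deg (R := R) [(0 : Fin n)] (d := 1) rfl) m
      rw [add_comm, hm] at this
      simpa using this
    have := rot_eq_self_of_mem_deg hn h0 x
    rw [map_mul, map_pow, rot_cyc, rot_vert, zero_add] at this
    simpa using this
  simpa [hbd] using this

end Chain

/-! ### Nonvanishing of the top power of the cycle modulo `p` -/

namespace Chain

variable {R : Type*} [CommRing R]

/-- The sum of the edges of the path `0, 1, …, k`. -/
noncomputable def path (R : Type*) [CommRing R] (k : ℕ) : Chain R ℕ :=
  ∑ i ∈ range k, vert R (i + 1) * vert R i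

theorem path_succ (k : ℕ) : path R (k + 1) = path R k + vert R (k + 1) * vert R k :=
  sum_range_succ _ _

theorem vert_mul_path (x k : ℕ) : vert R x * path R k = path R k * vert R x := by
  rw [path, mul_sum, sum_mul]
  refine sum_congr rfl fun i _ => ?_
  rw [vert_mul_vert_mul, vert_mul_vert x, mul_neg, neg_neg, mul_assoc]

theorem del_vert_mul_vert_mul_of_ne {X : Type*} {x y z : X} (h : x ≠ y) (h' : x ≠ z)
    (a : Chain R X) : del x (vert R y * vert R z * a) = vert R y * vert R z * del x a := by
  rw [mul_assoc, del_vert_mul_of_ne h, del_vert_mul_of_ne h', mul_neg, neg_neg, mul_assoc]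

theorem del_path_mul_of_lt {x k : ℕ} (h : k < x) (a : Chain R ℕ) :
    del x (path R k * a) = path R k * del x a := by
  rw [path, sum_mul, map_sum, sum_mul]
  refine sum_congr rfl fun i hi => ?_
  rw [mem_range] at hi
  exact del_vert_mul_vert_mul_of_ne (by omega) (by omega) a

theorem del_path_succ_mul (k : ℕ) (a : Chain R ℕ) :
    del (k + 1) (path R (k + 1) * a) = vert R k * a + path R (k + 1) * del (k + 1) a := by
  rw [path_succ, add_mul, map_add, del_path_mul_of_lt (Nat.lt_succ_self k), mul_assoc,
    del_vert_mul_self, del_vert_mul_of_ne (by omega), add_mul, mul_assoc]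
  noncomm_ring

/-- The power rule: `path` is a sum of edges, which commute with vertices, and `k + 1` lies on its
last edge only. -/
theorem del_path_succ_pow (k j : ℕ) :
    del (k + 1) (path R (k + 1) ^ (j + 1)) = (j + 1) • (vert R k * path R (k + 1) ^ j) := by
  induction j with
  | zero => simpa using del_path_succ_mul (R := R) k 1
  | succ j ih =>
    rw [pow_succ', del_path_succ_mul, ih, mul_smul_comm, ← mul_assoc (path R (k + 1)),
      ← vert_mul_path, mul_assoc, ← pow_succ', succ_nsmul _ (j + 1), add_comm]

/-- The algebra homomorphism that deletes the vertices beyond `k`. -/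
noncomputable def truncate (R : Type*) [CommRing R] (k : ℕ) : Chain R ℕ →ₐ[R] Chain R ℕ :=
  ExteriorAlgebra.map
    (Finsupp.linearCombination R fun i => if i ≤ k then Finsupp.single i (1 : R) else 0)

theorem truncate_vert_of_le {k i : ℕ} (h : i ≤ k) : truncate R k (vert R i) = vert R i := by
  simp [truncate, vert, h]

theorem truncate_vert_of_lt {k i : ℕ} (h : k < i) : truncate R k (vert R i) = 0 := by
  simp [truncate, vert, h.not_ge]

theorem truncate_path (k : ℕ) : truncate R k (path R (k + 2)) = path R k := by
  rw [path_succ, path_succ, map_add, map_add, map_mul, map_mul, truncate_vert_of_lt (i := k + 1) (by omega),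
    truncate_vert_of_lt (i := k + 1 + 1) (by omega), zero_mul, mul_zero, add_zero, add_zero, path,
    map_sum]
  refine sum_congr rfl fun i hi => ?_
  rw [mem_range] at hi
  rw [map_mul, truncate_vert_of_le (by omega), truncate_vert_of_le (by omega)]

/-- The only perfect matching of the path on `1, …, 2 * m` is `{1, 2}, {3, 4}, …`, and it arises
from `m!` orderings of its commuting edges. The scalar `r` accumulates these factors in the
induction. -/
theorem mul_factorial_eq_zero_of_smul_path_pow (m : ℕ) (r : R)
    (h : r • (vert R 0 * path R (2 * m) ^ m) = 0) : r * m.factorial = 0 := by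
  induction m generalizing r with
  | zero =>
    have := congrArg bd h
    rw [pow_zero, mul_one, map_smul, bd_vert, map_zero, ← Algebra.algebraMap_eq_smul_one] at this
    simpa using (ExteriorAlgebra.algebraMap_eq_zero_iff _ _).1 this
  | succ m ih =>
    -- Contracting with the last vertex selects the last edge in one of the `m + 1` factors.
    -- Contracting with the vertex before it and truncating then removes that edge and shortens the
    -- path by two.
    have h1 := congrArg (del (2 * m + 1 + 1)) h
    rw [map_smul, map_zero, mul_add_one, del_vert_mul_of_ne (by omega), del_path_succ_pow,
      mul_smul_comm, smul_neg, neg_eq_zero] at h1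
    have h2 := congrArg (truncate R (2 * m) ∘ del (2 * m + 1)) h1
    simp only [Function.comp_apply, map_smul, map_zero, map_nsmul] at h2
    rw [del_vert_mul_of_ne (by omega), del_vert_mul_self, map_neg, map_mul, map_sub, map_mul,
      truncate_vert_of_lt (i := 2 * m + 1) (by omega), zero_mul, sub_zero, map_pow, truncate_path,
      truncate_vert_of_le (by omega), smul_neg, smul_neg, neg_eq_zero,
      ← Nat.cast_smul_eq_nsmul R, smul_smul] at h2
    have := ih _ h2
    rw [Nat.factorial_succ]
    push_cast at this ⊢
    rw [← this]
    ring

theorem cyc_pow_mul_vert_ne_zero {p : ℕ} [Fact p.Prime] {m : ℕ} (hm : 2 * m + 1 = p) :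
    cyc (ZMod p) p ^ m * vert (ZMod p) 0 ≠ 0 := by
  intro h
  have hval := congrArg (chmap (ZMod p) (Fin.val : Fin p → ℕ)) h
  rw [map_mul, map_pow, map_zero, chmap_vert] at hval
  have hcyc : chmap (ZMod p) (Fin.val : Fin p → ℕ) (cyc (ZMod p) p) =
      path (ZMod p) (2 * m) + vert (ZMod p) 0 * vert (ZMod p) (2 * m) := by
    rw [cyc, map_sum]
    have : ∀ i : Fin p, chmap (ZMod p) (Fin.val : Fin p → ℕ)
        (vert (ZMod p) (i + 1) * vert (ZMod p) i) =
        vert (ZMod p) ((i.val + 1) % p) * vert (ZMod p) i.val := fun i => by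
      rw [map_mul, chmap_vert, chmap_vert]
      simp [Fin.val_add]
    rw [sum_congr rfl fun i _ => this i,
      Fin.sum_univ_eq_sum_range (fun i => vert (ZMod p) ((i + 1) % p) * vert (ZMod p) i)]
    rw [show range p = range (2 * m + 1) by rw [hm], sum_range_succ, hm, Nat.mod_self, path]
    congr 1
    refine sum_congr rfl fun i hi => ?_
    rw [mem_range] at hi
    rw [Nat.mod_eq_of_lt (by omega)]
  -- The closing edge contains vertex `0`, so it is killed by `vert (ZMod p) 0`.
  have hpow (j : ℕ) : (path (ZMod p) (2 * m) + vert (ZMod p) 0 * vert (ZMod p) (2 * m)) ^ j *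
      vert (ZMod p) 0 = vert (ZMod p) 0 * path (ZMod p) (2 * m) ^ j := by
    induction j with
    | zero => simp
    | succ j ih =>
      rw [pow_succ', mul_assoc, ih, add_mul, mul_assoc (vert (ZMod p) 0), vert_mul_vert_mul _ 0,
        mul_neg, vert_mul_self_mul, neg_zero, add_zero, ← mul_assoc, ← vert_mul_path, mul_assoc,
        ← pow_succ']
  rw [hcyc, Fin.val_zero, hpow] at hval
  have hfac := mul_factorial_eq_zero_of_smul_path_pow m (1 : ZMod p) (by rw [one_smul, hval])
  rw [one_mul, ZMod.natCast_eq_zero_iff, (Fact.out : p.Prime).dvd_factorial] at hfac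
  omega

end Chain

/-! ### Equivariant chain maps do not vanish in top degree -/

namespace Chain

variable {R : Type*} [CommRing R] {V W J : Type*}

theorem chmap_mem_rook [Fintype V] [Fintype W] {f : V → W} (hf : Function.Injective f)
    {K : Finset J} {d : ℕ} {z : Chain R (V × J)} (hz : z ∈ rook R univ K d) :
    chmap R (Prod.map f id) z ∈ rook R univ K d := by
  refine rook_map_mem (chmap R (Prod.map f id)).toLinearMap (fun L hL => ?_) hz
  rw [AlgHom.toLinearMap_apply, chmap_mono]
  refine mono_mem_rook ⟨by simp [hL.length_eq], ?_, fun x _ => mem_univ _, ?_, fun x hx => ?_⟩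
  · have : (L.map (Prod.map f id)).map Prod.fst = (L.map Prod.fst).map f := by simp
    rw [this]
    exact hL.row_nodup.map hf
  · have : (L.map (Prod.map f (id : J → J))).map Prod.snd = L.map Prod.snd := by simp
    rw [this]
    exact hL.col_nodup
  · obtain ⟨y, hy, rfl⟩ := List.mem_map.1 hx
    exact hL.col_mem y hy

theorem chmap_chmap {X Y Z : Type*} (f : X → Y) (g : Y → Z) (z : Chain R X) :
    chmap R g (chmap R f z) = chmap R (g ∘ f) z := by
  have : (chmap R g).comp (chmap R f) = chmap R (g ∘ f) := by
    refine ExteriorAlgebra.hom_ext (Finsupp.lhom_ext fun x r => ?_)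
    simp [chmap]
  exact DFunLike.congr_fun this z

variable {n N : ℕ} [NeZero n]

/-- The rotations of the cycle act on the chains of the chessboard complex. -/
noncomputable def rowRot (R : Type*) [CommRing R] (N : ℕ) (i : Fin n) :
    Chain R (Fin n × Fin N) →ₐ[R] Chain R (Fin n × Fin N) :=
  chmap R (Prod.map (· + i) id)

theorem rowRot_rowRot (i j : Fin n) (z : Chain R (Fin n × Fin N)) :
    rowRot R N j (rowRot R N i z) = rowRot R N (i + j) z := by
  refine (chmap_chmap _ _ z).trans ?_
  congr 1
  congr 1
  exact funext fun x => Prod.ext (add_assoc _ _ _) rfl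

theorem bd_rowRot (i : Fin n) (z : Chain R (Fin n × Fin N)) :
    bd (rowRot R N i z) = rowRot R N i (bd z) :=
  bd_chmap _ _

theorem rowRot_mem_rook (i : Fin n) {d : ℕ} {z : Chain R (Fin n × Fin N)}
    (hz : z ∈ rook R univ univ d) : rowRot R N i z ∈ rook R univ univ d :=
  chmap_mem_rook (add_left_injective i) hz

theorem exists_bd_eq_sub_rowRot {d : ℕ} (hd : d + 1 ≤ n) (hN : 2 * d + 1 ≤ N)
    {z : Chain R (Fin n × Fin N)} (hz : z ∈ rook R univ univ d)
    (hinv : ∀ i : Fin n, rowRot R N i (bd z) = bd z) :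
    ∃ w ∈ rook R univ univ (d + 1), bd w = z - rowRot R N 1 z :=
  exists_bd_eq_of_mem_rook d univ univ (by simpa) (by simpa) _
    (sub_mem hz (rowRot_mem_rook 1 hz)) (by rw [map_sub, bd_rowRot, hinv, sub_self])

/-- The boundary of the orbit sum of `w` is the orbit sum of `z - rowRot R N 1 z`, which telescopes
to zero. -/
theorem exists_bd_eq_sum_rowRot {d : ℕ} (hd : d + 1 ≤ n) (hN : 2 * d + 1 ≤ N)
    {z w : Chain R (Fin n × Fin N)} (hw : w ∈ rook R univ univ d)
    (hbw : bd w = z - rowRot R N 1 z) :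
    ∃ u ∈ rook R univ univ (d + 1), bd u = ∑ i, rowRot R N i w := by
  refine exists_bd_eq_of_mem_rook d univ univ (by simpa) (by simpa) _
    (sum_mem fun i _ => rowRot_mem_rook i hw) ?_
  have h := sum_add_right (fun i : Fin n => rowRot R N i z) 1
  simp only [map_sum, bd_rowRot, hbw, map_sub, rowRot_rowRot]
  rw [sum_sub_distrib, sub_eq_zero, ← h]
  simp only [add_comm]

/-- A chain map from the chessboard complex to the simplex on the vertices of an odd cycle which
commutes with rotations does not vanish in top degree. -/
theorem exists_mem_rook_map_eq_cyc_pow_mul (hn : Odd n) (hR : (n : R) = 0) (hN : 2 * n - 1 ≤ N)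
    (F : Chain R (Fin n × Fin N) →ₗ[R] Chain R (Fin n)) (hF1 : F 1 = 1)
    (hFbd : ∀ d, ∀ z ∈ rook R univ univ d, bd (F z) = F (bd z))
    (hFdeg : ∀ d, ∀ z ∈ rook R univ univ d, F z ∈ deg R (Fin n) d)
    (hFrot : ∀ d, ∀ z ∈ rook R univ univ d, ∀ i : Fin n, F (rowRot R N i z) = rot R i (F z))
    {m : ℕ} (hm : 2 * m + 1 = n) :
    ∃ z ∈ rook R univ univ n, F z = cyc R n ^ m * vert R 0 := by
  -- Multiplying by `cyc R n ^ j` lifts the image of a low-dimensional chain to top degree, so the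
  -- final value can be tracked from the first vertex on. Each step trades one factor `cyc` for two
  -- dimensions of the chessboard chain.
  suffices h : ∀ k j, k + j = m → ∃ z ∈ rook R univ univ (2 * k + 1),
      (∀ i : Fin n, rowRot R N i (bd z) = bd z) ∧
        cyc R n ^ j * F z = cyc R n ^ m * vert R 0 by
    obtain ⟨z, hz, -, h⟩ := h m 0 rfl
    exact ⟨z, by rwa [hm] at hz, by simpa using h⟩
  intro k
  induction k with
  | zero =>
    intro j hj
    rw [zero_add] at hj
    subst hj
    have hz : vert R ((0 : Fin n), (⟨0, by omega⟩ : Fin N)) ∈ rook R univ univ 1 := by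
      have : IsRookList univ univ 1 [((0 : Fin n), (⟨0, by omega⟩ : Fin N))] :=
        ⟨rfl, List.nodup_singleton _, by simp, List.nodup_singleton _, by simp⟩
      simpa using mono_mem_rook (R := R) this
    refine ⟨_, hz, fun i => by rw [bd_vert, map_one], ?_⟩
    exact cyc_pow_mul_eq hn hm (hFdeg 1 _ hz) (by rw [hFbd 1 _ hz, bd_vert, hF1])
  | succ k ih =>
    intro j hj
    obtain ⟨z, hz, hinv, hFz⟩ := ih (j + 1) (by omega)
    -- The largest degree filled, in the second step for `k + 1 = m`, is `d = n - 1`; its condition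
    -- `2 * d + 1 ≤ N` is exactly `hN`.
    obtain ⟨w, hw, hbw⟩ := exists_bd_eq_sub_rowRot (by omega) (by omega) hz hinv
    obtain ⟨u, hu, hbu⟩ := exists_bd_eq_sum_rowRot (by omega) (by omega) hw hbw
    refine ⟨u, hu, fun i => ?_, ?_⟩
    · rw [hbu, map_sum]
      simp only [rowRot_rowRot]
      exact sum_add_right (fun l : Fin n => rowRot R N l w) i
    · rw [← hFz, pow_succ', mul_assoc]
      have hX := cyc_pow_mul_mem_deg (hFdeg _ _ hz) j
      have hY := cyc_pow_mul_mem_deg (hFdeg _ _ hw) j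
      have hZ := cyc_pow_mul_mem_deg (hFdeg _ _ hu) j
      rw [show 2 * k + 1 + 1 + 2 * j = 2 * k + 1 + 2 * j + 1 by ring] at hY
      rw [show 2 * k + 1 + 1 + 1 + 2 * j = n by omega] at hZ
      refine eq_cyc_mul_of_bd hn hR (by omega) hX hY hZ ?_ ?_
      · rw [bd_cyc_pow_mul, hFbd _ _ hw, hbw, map_sub, hFrot _ _ hz, mul_sub, map_mul, map_pow,
          rot_cyc]
      · rw [bd_cyc_pow_mul, hFbd _ _ hu, hbu, map_sum, mul_sum]
        refine sum_congr rfl fun i _ => ?_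
        rw [hFrot _ _ hw, map_mul, map_pow, rot_cyc]

end Chain

/-! ### From colors to nodes, and the conclusion -/

namespace AsyncLocal

/-- The rotations of the cycle graph. -/
def cycleRotation {n : ℕ} [NeZero n] (i : Fin n) :
    SimpleGraph.cycleGraph n ≃g SimpleGraph.cycleGraph n where
  toEquiv := Equiv.addRight i
  map_rel_iff' {u v} := by
    simp [SimpleGraph.cycleGraph_adj']

/-- Colors `0` and `1` move the node to the next one, colors `2` and `3` do not move it. -/
def moveNode {n : ℕ} [NeZero n] (v : Fin n) (c : Fin 4) : Fin n :=
  if c < 2 then v + 1 else v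

/-- If a node moves, its successor must move too, lest they collide; around the cycle, all move or
all stay. Then only two colors occur, distinguished by parity, although an odd cycle needs three. -/
theorem moveNode_not_injective {n : ℕ} [NeZero n] (hn : Odd n) (hn3 : 3 ≤ n) (col : Fin n → Fin 4)
    (hcol : ∀ u v, (SimpleGraph.cycleGraph n).Adj u v → col u ≠ col v) :
    ¬ Function.Injective fun v => moveNode v (col v) := by
  intro hinj
  have hone : (1 : Fin n) ≠ 0 := by
    intro h
    have := congrArg Fin.val h
    rw [Fin.val_zero, Fin.val_one', Nat.mod_eq_of_lt (by omega)] at this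
    omega
  have hstep (v : Fin n) (hv : col v < 2) : col (v + 1) < 2 := by
    by_contra h
    have := @hinj v (v + 1) (by simp [moveNode, hv, h])
    exact hone (by simpa using this)
  have hall (v : Fin n) (hv : col v < 2) (u : Fin n) : col u < 2 := by
    have h (j : ℕ) : col (v + Fin.ofNat n j) < 2 := by
      induction j with
      | zero => simpa using hv
      | succ j ih =>
        have e : Fin.ofNat n (j + 1) = Fin.ofNat n j + 1 := by
          simp [Fin.ext_iff, Fin.val_add]
        rw [e, ← add_assoc]
        exact hstep _ ih
    simpa using h (u - v).val
  have hcolorable : (SimpleGraph.cycleGraph n).Colorable 2 := by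
    refine ⟨SimpleGraph.Coloring.mk (fun v => (⟨(col v).val % 2, by omega⟩ : Fin 2)) ?_⟩
    intro u v huv h
    refine hcol u v huv (Fin.ext ?_)
    rw [Fin.ext_iff] at h
    dsimp only at h
    by_cases hu : col u < 2
    · have hv := hall u hu v
      rw [Fin.lt_def] at hu hv
      change (col u).val < 2 at hu
      change (col v).val < 2 at hv
      omega
    · have hv : ¬ col v < 2 := fun hv => hu (hall v hv u)
      rw [Fin.lt_def] at hu hv
      change ¬ (col u).val < 2 at hu
      change ¬ (col v).val < 2 at hv
      omega
  have h := hcolorable.chromaticNumber_le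
  rw [SimpleGraph.chromaticNumber_cycleGraph_of_odd n (by omega) hn] at h
  exact absurd h (by decide)

end AsyncLocal

theorem corollary5 (n : ℕ) (hprime : n.Prime) (hn : 3 ≤ n) (N : ℕ) (hN : 2 * n - 1 ≤ N)
    {I Q : Type*} (A : AsyncLocal.Algorithm I Q (Fin 4)) (x : I) :
    ¬ A.SolvesColoring (SimpleGraph.cycleGraph n) N (fun _ => x) := by
  intro hA
  have : Fact n.Prime := ⟨hprime⟩
  have hodd : Odd n := hprime.odd_of_ne_two (by omega)
  obtain ⟨m, hm⟩ := id hodd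
  have hcard : Fintype.card (Fin n) ≤ N := by
    rw [Fintype.card_fin]
    omega
  obtain ⟨z, hz, h⟩ := Chain.exists_mem_rook_map_eq_cyc_pow_mul (R := ZMod n) hodd (by simp) hN
    (AsyncLocal.Algorithm.outMap (ZMod n) hA AsyncLocal.moveNode)
    (AsyncLocal.Algorithm.outMap_one hA _ hcard)
    (fun d z hz => AsyncLocal.Algorithm.bd_outMap hA _ hcard hz)
    (fun d z hz => AsyncLocal.Algorithm.outMap_mem hA _ hcard hz
      fun L hL => Chain.mono_mem_deg L hL)
    (fun d z hz i => AsyncLocal.Algorithm.outMap_chmap _ hA hcard (AsyncLocal.cycleRotation i)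
      (fun v c => by
        simp only [AsyncLocal.moveNode, AsyncLocal.cycleRotation]
        split
        · exact add_right_comm v i 1
        · rfl) hz)
    hm.symm
  refine Chain.cyc_pow_mul_vert_ne_zero hm.symm (h.symm.trans ?_)
  exact AsyncLocal.Algorithm.outMap_eq_zero hA _ hcard
    (fun col hcol => AsyncLocal.moveNode_not_injective hodd hn col hcol) (by simpa using hz)
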